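/- Let $X$ and $U$ be (real or complex) Banach lattices with positive cones $X^+$, $U^+$, let $\partial X$ be a Banach space, $A_m:D(A_m)\subseteq X\to X$ a closed, densely defined operator, $Q:D(A_m)\to\partial X$ a surjective linear operator that is bounded for the graph norm of $A_m$, and $B\in\mathcal L(U,\partial X)$. Assume that $A:=A_m|_{\ker Q}$ generates a strongly continuous semigroup $(T(t))_{t\ge0}$ on $X$, with growth bound $\omega_0(A)\in[-\infty,\infty)$. For $\lambda\in\rho(A)$ put $Q_\lambda:=(Q|_{\ker(\lambda-A_m)})^{-1}:\partial X\to X$ and $B_\lambda:=Q_\lambda B$. Let $1\le p\le\infty$ and suppose that $B$ is $p$-boundary admissible, i.e. there are $t>0$ and $\lambda\in\rho(A)$ with $\int_0^tT(t-s)B_\lambda u(s)\,ds\in D(A)$ for all $u\in L^p([0,t],U)$. Let $\mathcal B_tu:=(\lambda-A)\int_0^tT(t-s)B_\lambda u(s)\,ds$ for $u\in L^p([0,t],U)$, $t\ge0$ (for any $\lambda\in\rho(A)$; the choice does not matter), and $$e^+\mathcal R_t:=\{\mathcal B_tu:u\in L^p([0,t],U^+)\},\quad a^+\mathcal R_t:=\overline{e^+\mathcal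 R_t},\quad e^+\mathcal R:=\bigcup_{t\ge0}e^+\mathcal R_t,\quad a^+\mathcal R:=\overline{\bigcup_{t\ge0}a^+\mathcal R_t}.$$ An operator $S$ from $U$ to $X$ satisfies $S\ge0$ if $SU^+\subseteq X^+$. (1) For every $t\ge0$ the following are equivalent: (a) $e^+\mathcal R_t\subseteq X^+$; (b) $a^+\mathcal R_t\subseteq X^+$; (c) there is $\lambda\in\mathbb R\cap\rho(A)$ such that $\bigl(e^{\lambda\beta}T(t-\beta)-e^{\lambda\alpha}T(t-\alpha)\bigr)B_\lambda\ge0$ for all $0\le\alpha\le\beta\le t$. (2) If $T(s)X^+\subseteq X^+$ for all $s\ge0$, then for every $t>0$ the conditions (a), (b), (c) are also equivalent to each of the following: (d) $e^+\mathcal R\subseteq X^+$; (e) $a^+\mathcal R\subseteq X^+$; (f) there are a real $\lambda>\omega_0(A)$ and $\tau>0$ such that $\bigl(e^{\lambda s}-T(s)\bigr)B_\lambda\ge0$ for all $0\le s\le\tau$; (g) there is a real $\lambda_0>\omega_0(A)$ such that $B_\lambda\ge0$ for all real $\lambda\ge\lambda_0$. -/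

import Mathlib

open MeasureTheory Filter Topology

/-- A strongly continuous one-parameter semigroup of bounded linear operators. Only the operators
`T t` with `0 ≤ t` are meaningful. -/
structure C0Semigroup (𝕜 X : Type*) [RCLike 𝕜] [NormedAddCommGroup X] [NormedSpace 𝕜 X] where
  op : ℝ → X →L[𝕜] X
  op_zero : op 0 = ContinuousLinearMap.id 𝕜 X
  op_add : ∀ s t : ℝ, 0 ≤ s → 0 ≤ t → op (s + t) = (op s).comp (op t)
  continuousOn : ∀ x : X, ContinuousOn (fun t => op t x) (Set.Ici 0)

namespace C0Semigroup

variable {𝕜 X : Type*} [RCLike 𝕜] [NormedAddCommGroup X] [NormedSpace 𝕜 X]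

/-- The growth bound, an element of `[-∞, ∞]`. -/
noncomputable def growthBound (T : C0Semigroup 𝕜 X) : EReal :=
  sInf {w : EReal | ∃ ω : ℝ, w = (ω : EReal) ∧
    ∃ M : ℝ, ∀ t : ℝ, 0 ≤ t → ‖T.op t‖ ≤ M * Real.exp (ω * t)}

/-- `A` (with its domain) is the infinitesimal generator of `T`. -/
def IsGenerator [NormedSpace ℝ X] (T : C0Semigroup 𝕜 X) (A : X →ₗ.[𝕜] X) : Prop :=
  ∀ x y : X, (∃ h : x ∈ A.domain, A ⟨x, h⟩ = y) ↔
    Tendsto (fun h : ℝ => h⁻¹ • (T.op h x - x)) (𝓝[>] 0) (𝓝 y)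

end C0Semigroup

/-- The resolvent set of an unbounded operator: `lam - A` has an everywhere defined bounded
two-sided inverse. -/
def resolventSetOf {𝕜 X : Type*} [RCLike 𝕜] [NormedAddCommGroup X] [NormedSpace 𝕜 X]
    (A : X →ₗ.[𝕜] X) : Set 𝕜 :=
  {lam | ∃ R : X →L[𝕜] X,
    (∀ x : X, ∃ h : R x ∈ A.domain, lam • R x - A ⟨R x, h⟩ = x) ∧
    (∀ x : A.domain, R (lam • (x : X) - A x) = x)}

/-- `X` is a Banach lattice over `𝕜` (`ℝ` or `ℂ`) with real part the real normed lattice `E`.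
For `𝕜 = ℝ` this identifies `X` with `E`; for `𝕜 = ℂ` it says that `X = E ⊕ i E` is the
complexification of `E`, with the norm `‖x‖ = ‖ |x| ‖` where `|x|` is the supremum of
`Re (c x)` over the scalars `c` of modulus one. (Completeness is required separately of `X`,
and `E` is then complete, being a closed subspace.) -/
structure BanachLatticeOver (𝕜 E X : Type*) [RCLike 𝕜]
    [NormedAddCommGroup E] [Lattice E] [HasSolidNorm E] [IsOrderedAddMonoid E]
    [NormedSpace ℝ E] [IsOrderedModule ℝ E]
    [NormedAddCommGroup X] [NormedSpace ℝ X] [NormedSpace 𝕜 X] where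
  incl : E →ₗ[ℝ] X
  re : X →ₗ[ℝ] E
  re_incl : ∀ a : E, re (incl a) = a
  re_I_smul_incl : ∀ a : E, re ((RCLike.I : 𝕜) • incl a) = 0
  incl_add_I_smul_incl : ∀ x : X,
    incl (re x) + (RCLike.I : 𝕜) • incl (re (-((RCLike.I : 𝕜) • x))) = x
  norm_eq_norm_modulus : ∀ x : X, ∃ m : E,
    IsLUB {a : E | ∃ c : 𝕜, ‖c‖ = 1 ∧ a = re (c • x)} m ∧ ‖x‖ = ‖m‖

/-- The positive cone of a (real or complex) Banach lattice. -/
def BanachLatticeOver.cone {𝕜 E X : Type*} [RCLike 𝕜]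
    [NormedAddCommGroup E] [Lattice E] [HasSolidNorm E] [IsOrderedAddMonoid E]
    [NormedSpace ℝ E] [IsOrderedModule ℝ E]
    [NormedAddCommGroup X] [NormedSpace ℝ X] [NormedSpace 𝕜 X]
    (L : BanachLatticeOver 𝕜 E X) : Set X :=
  L.incl '' {a : E | 0 ≤ a}

/-- An abstract boundary control system on the state space `X`, boundary space `Y` and control
space `U`: a closed, densely defined `Am`, a surjective boundary operator `Q`, bounded for the
graph norm of `Am`, and a control operator `B`, such that the restriction of `Am` to `ker Q`
generates the strongly continuous semigroup `T`. -/
structure BoundaryControlSystem (𝕜 X Y U : Type*) [RCLike 𝕜]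
    [NormedAddCommGroup X] [NormedSpace ℝ X] [NormedSpace 𝕜 X]
    [NormedAddCommGroup Y] [NormedSpace 𝕜 Y]
    [NormedAddCommGroup U] [NormedSpace 𝕜 U] where
  Am : X →ₗ.[𝕜] X
  Am_closed : Am.IsClosed
  Am_dense : Dense (Am.domain : Set X)
  Q : Am.domain →ₗ[𝕜] Y
  Q_bounded : ∃ C : ℝ, ∀ x : Am.domain, ‖Q x‖ ≤ C * (‖(x : X)‖ + ‖Am x‖)
  Q_surjective : Function.Surjective Q
  B : U →L[𝕜] Y
  T : C0Semigroup 𝕜 X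
  T_generator :
    T.IsGenerator (Am.domRestrict ((LinearMap.ker Q).map Am.domain.subtype))

namespace BoundaryControlSystem

variable {𝕜 X Y U : Type*} [RCLike 𝕜]
    [NormedAddCommGroup X] [NormedSpace ℝ X] [NormedSpace 𝕜 X]
    [NormedAddCommGroup Y] [NormedSpace 𝕜 Y]
    [NormedAddCommGroup U] [NormedSpace 𝕜 U]
    (S : BoundaryControlSystem 𝕜 X Y U)

/-- The operator `A`: the restriction of `Am` to `ker Q`. -/
def A : X →ₗ.[𝕜] X :=
  S.Am.domRestrict ((LinearMap.ker S.Q).map S.Am.domain.subtype)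

/-- `ker (lam - Am)`, as a subspace of the domain of `Am`. -/
def eigenspace (lam : 𝕜) : Submodule 𝕜 S.Am.domain :=
  LinearMap.ker (lam • S.Am.domain.subtype - S.Am.toFun)

theorem mem_A_domain (x : S.Am.domain) (hx : S.Q x = 0) : (x : X) ∈ S.A.domain :=
  ⟨⟨x, hx, rfl⟩, x.2⟩

theorem A_apply (x : X) (h : x ∈ S.A.domain) : S.A ⟨x, h⟩ = S.Am ⟨x, h.2⟩ := rfl

theorem Q_eq_zero (x : X) (h : x ∈ S.A.domain) : S.Q ⟨x, h.2⟩ = 0 := by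
  obtain ⟨⟨y, hy, hyx⟩, _⟩ := h
  subst hyx
  exact hy

/-- For `lam` in the resolvent set of `A`, the restriction of `Q` to `ker (lam - Am)` is
bijective. -/
theorem Q_bijective {lam : 𝕜} (hlam : lam ∈ resolventSetOf S.A) :
    Function.Bijective (S.Q.domRestrict (S.eigenspace lam)) := by
  obtain ⟨R, hR1, hR2⟩ := hlam
  constructor
  · rw [← LinearMap.ker_eq_bot, LinearMap.ker_eq_bot']
    rintro ⟨x, hx⟩ hQ
    have hQ' : S.Q x = 0 := hQ
    have hx' : lam • (x : X) - S.Am x = 0 := hx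
    have h2 := hR2 ⟨x, S.mem_A_domain x hQ'⟩
    rw [A_apply] at h2
    have h3 : R (lam • (x : X) - S.Am x) = x := h2
    rw [hx', map_zero] at h3
    exact Subtype.ext (Subtype.ext h3.symm)
  · intro y
    obtain ⟨x, rfl⟩ := S.Q_surjective y
    obtain ⟨h, e⟩ := hR1 (lam • (x : X) - S.Am x)
    rw [A_apply] at e
    set z : S.Am.domain := ⟨R (lam • (x : X) - S.Am x), h.2⟩ with hz
    refine ⟨⟨x - z, ?_⟩, ?_⟩
    · change lam • ((x - z : S.Am.domain) : X) - S.Am (x - z) = 0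
      have e' : lam • (z : X) - S.Am z = lam • (x : X) - S.Am x := e
      rw [LinearPMap.map_sub, Submodule.coe_sub, smul_sub, sub_sub_sub_comm, e', sub_self]
    · change S.Q (x - z) = S.Q x
      rw [map_sub, S.Q_eq_zero _ h, sub_zero]

/-- The Dirichlet operator `(Q restricted to ker (lam - Am))⁻¹`. -/
noncomputable def dirichlet {lam : 𝕜} (hlam : lam ∈ resolventSetOf S.A) : Y →ₗ[𝕜] X :=
  S.Am.domain.subtype ∘ₗ (S.eigenspace lam).subtype ∘ₗ
    (LinearEquiv.ofBijective _ (S.Q_bijective hlam)).symm.toLinearMap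

/-- The operator `B_lam`, the Dirichlet operator composed with `B`. -/
noncomputable def Bop {lam : 𝕜} (hlam : lam ∈ resolventSetOf S.A) : U →ₗ[𝕜] X :=
  S.dirichlet hlam ∘ₗ S.B.toLinearMap

/-- The integral `∫₀ᵗ T(t-s) B_lam u(s) ds`. -/
noncomputable def controlIntegral {lam : 𝕜} (hlam : lam ∈ resolventSetOf S.A) (t : ℝ)
    (u : ℝ → U) : X :=
  ∫ s in (0 : ℝ)..t, S.T.op (t - s) (S.Bop hlam (u s))

/-- `B` is `p`-boundary admissible. -/
def IsAdmissible (p : ENNReal) : Prop :=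
  ∃ t : ℝ, 0 < t ∧ ∃ (lam : 𝕜) (hlam : lam ∈ resolventSetOf S.A),
    ∀ u : ℝ → U, MemLp u p (volume.restrict (Set.Icc 0 t)) →
      S.controlIntegral hlam t u ∈ S.A.domain

/-- `x` is the value at `u` of the controllability map
`u ↦ (lam - A) ∫₀ᵗ T(t-s) B_lam u(s) ds`. -/
def IsControlValue {lam : 𝕜} (hlam : lam ∈ resolventSetOf S.A) (t : ℝ) (u : ℝ → U) (x : X) :
    Prop :=
  ∃ h : S.controlIntegral hlam t u ∈ S.A.domain,
    x = lam • S.controlIntegral hlam t u - S.A ⟨S.controlIntegral hlam t u, h⟩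

/-- The exact positive reachability space in time `t`, for `L^p`-controls with values in the
cone `K` of `U`. The controllability map is written with the resolvent point `lam`. -/
def exactPos {lam : 𝕜} (hlam : lam ∈ resolventSetOf S.A) (p : ENNReal) (K : Set U) (t : ℝ) :
    Set X :=
  {x | ∃ u : ℝ → U, MemLp u p (volume.restrict (Set.Icc 0 t)) ∧
    (∀ᵐ s ∂(volume.restrict (Set.Icc 0 t)), u s ∈ K) ∧ S.IsControlValue hlam t u x}

/-- The exact positive reachability space in arbitrary time. -/
def exactPosAll {lam : 𝕜} (hlam : lam ∈ resolventSetOf S.A) (p : ENNReal) (K : Set U) : Set X :=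
  ⋃ t ∈ Set.Ici (0 : ℝ), S.exactPos hlam p K t

/-- The approximate positive reachability space in time `t`. -/
def approxPos {lam : 𝕜} (hlam : lam ∈ resolventSetOf S.A) (p : ENNReal) (K : Set U) (t : ℝ) :
    Set X :=
  closure (S.exactPos hlam p K t)

/-- The approximate positive reachability space in arbitrary time. -/
def approxPosAll {lam : 𝕜} (hlam : lam ∈ resolventSetOf S.A) (p : ENNReal) (K : Set U) : Set X :=
  closure (⋃ t ∈ Set.Ici (0 : ℝ), S.approxPos hlam p K t)

end BoundaryControlSystem

/-! The cone of a Banach lattice enters only as a closed convex cone, so passing to closures of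
reachability spaces costs nothing. The link to (c) is one computation: for real `lam`, the control
`exp (lam s) • v` on `(α, β]` is sent by the controllability map exactly to the increment `exp (lam
β) T(t-β) B_lam v - exp (lam α) T(t-α) B_lam v` (`gen_integral`, `isControlValue_indicator_Ioc`).
Hence (a) gives (c) by testing.

For the converse, sums of such controls must approximate every positive control. Norm continuity on
`L^p` is not enough when `p = ∞`, since interval step functions are not dense there. Instead, the
controllability map is a pointwise limit of operators bounded on `L¹`, and a Baire category argument
(`exists_delta_norm_limit_le`) makes it continuous at zero for the `L¹` norm on each order interval
`‖w‖ ≤ g` with `g` in `L^p`. Dominated `L¹` approximation then suffices, for all `p ≥ 1` at once.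

For a positive semigroup the cycle is (a) ⇒ (f) ⇒ (g) ⇒ (d) ⇒ (a). Increments ending at time `t`
give (f). Doubling the time extends (f) to all `s ≥ 0`, and a Laplace transform turns it into
positivity of `B_ν` for `ν > lam`. Finally `R(ν, A)` maps a control value to `∫ T(t-s) B_ν u(s) ds`,
which is positive under (g), and an element with positive resolvents for all large `ν` is positive
(`mem_of_resolvent_mem`). -/

/-- A Bochner integral of a function with values in a closed convex cone lies in the cone. -/
theorem integral_mem_of_isClosed_cone {X α : Type*} [NormedAddCommGroup X] [NormedSpace ℝ X]
    [CompleteSpace X] [MeasurableSpace α] {ν : Measure α} {K : Set X} (hK : IsClosed K)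
    (h0 : (0 : X) ∈ K) (hadd : ∀ x ∈ K, ∀ y ∈ K, x + y ∈ K)
    (hsmul : ∀ c : ℝ, 0 ≤ c → ∀ x ∈ K, c • x ∈ K) {f : α → X} (hf : ∀ᵐ a ∂ν, f a ∈ K) :
    ∫ a, f a ∂ν ∈ K := by
  -- Without integrability the integral is `0` by convention, which still lies in the cone.
  by_cases hi : Integrable f ν
  swap
  · rwa [integral_undef hi]
  by_contra hx
  have hconv : Convex ℝ K := fun x hx y hy a b ha hb _ =>
    hadd _ (hsmul a ha x hx) _ (hsmul b hb y hy)
  obtain ⟨φ, u, hu, hφ⟩ := geometric_hahn_banach_point_closed hconv hK hx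
  have hu0 : u < 0 := by simpa using hφ 0 h0
  have hpos : ∀ x ∈ K, 0 ≤ φ x := by
    intro x hx
    by_contra! hneg
    -- Scaling `x` by `u / φ x` would give a point of the cone at which `φ` equals the separating
    -- level `u`.
    have h1 := hφ _ (hsmul (u / φ x) (div_nonneg_of_nonpos hu0.le hneg.le) x hx)
    rw [map_smul, smul_eq_mul, div_mul_cancel₀ _ hneg.ne] at h1
    exact lt_irrefl _ h1
  rw [← φ.integral_comp_comm hi] at hu
  have : 0 ≤ ∫ a, φ (f a) ∂ν := integral_nonneg_of_ae (hf.mono fun a ha => hpos _ ha)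
  linarith

/-! ### Closedness of the positive cone. -/

namespace BanachLatticeOver

variable {𝕜 E X : Type*} [RCLike 𝕜]
    [NormedAddCommGroup E] [Lattice E] [HasSolidNorm E] [IsOrderedAddMonoid E]
    [NormedSpace ℝ E] [IsOrderedModule ℝ E]
    [NormedAddCommGroup X] [NormedSpace ℝ X] [NormedSpace 𝕜 X]
    (L : BanachLatticeOver 𝕜 E X)

theorem mem_cone_iff {x : X} : x ∈ L.cone ↔ 0 ≤ L.re x ∧ L.incl (L.re x) = x := by
  constructor
  · rintro ⟨a, ha, rfl⟩
    rw [L.re_incl]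
    exact ⟨ha, rfl⟩
  · rintro ⟨h, h'⟩
    exact ⟨_, h, h'⟩

theorem zero_mem_cone : (0 : X) ∈ L.cone := ⟨0, le_refl (0 : E), map_zero _⟩

theorem add_mem_cone : ∀ x ∈ L.cone, ∀ y ∈ L.cone, x + y ∈ L.cone := by
  rintro _ ⟨a, ha, rfl⟩ _ ⟨b, hb, rfl⟩
  exact ⟨a + b, add_nonneg (show 0 ≤ a from ha) hb, map_add _ _ _⟩

theorem smul_mem_cone : ∀ c : ℝ, 0 ≤ c → ∀ x ∈ L.cone, c • x ∈ L.cone := by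
  rintro c hc _ ⟨a, ha, rfl⟩
  exact ⟨c • a, smul_nonneg hc (show 0 ≤ a from ha), map_smul _ _ _⟩

theorem norm_re_le (x : X) : ‖L.re x‖ ≤ ‖x‖ := by
  obtain ⟨m, hm, hx⟩ := L.norm_eq_norm_modulus x
  rw [hx]
  apply norm_le_norm_of_abs_le_abs
  refine le_trans (abs_le'.2 ⟨hm.1 ⟨1, by simp, by simp⟩, hm.1 ⟨-1, by simp, ?_⟩⟩) (le_abs_self m)
  rw [neg_smul, one_smul, map_neg]

theorem continuous_re : Continuous L.re :=
  (L.re.mkContinuous 1 (by simpa using L.norm_re_le)).continuous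

variable [IsScalarTower ℝ 𝕜 X]

theorem re_smul_incl (c : 𝕜) (a : E) : L.re (c • L.incl a) = RCLike.re c • a := by
  have h : c • L.incl a = (RCLike.re c) • L.incl a + (RCLike.im c) • ((RCLike.I : 𝕜) • L.incl a) := by
    conv_lhs => rw [← RCLike.re_add_im c]
    rw [add_smul, mul_smul, ← RCLike.real_smul_eq_coe_smul, ← RCLike.real_smul_eq_coe_smul]
  rw [h, map_add, map_smul, map_smul, L.re_incl, L.re_I_smul_incl, smul_zero, add_zero]

/-- The modulus `m` of `incl a` satisfies `0 ≤ m ≤ |a|`, because `Re c • a ≤ |a|` whenever `|Re c| ≤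
1`; solidity of the norm does the rest. -/
theorem norm_incl_le (a : E) : ‖L.incl a‖ ≤ ‖a‖ := by
  obtain ⟨m, hm, hx⟩ := L.norm_eq_norm_modulus (L.incl a)
  rw [hx]
  apply norm_le_norm_of_abs_le_abs
  have h1 : m ≤ |a| := by
    apply hm.2
    rintro _ ⟨c, hc, rfl⟩
    rw [re_smul_incl]
    have hre : |RCLike.re c| ≤ 1 := hc ▸ RCLike.abs_re_le_norm c
    rw [abs_le] at hre
    -- Twice `|a| - Re c • a` is a combination of the positive elements `|a| ± a` with nonnegative
    -- weights `1 ∓ Re c`.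
    have h2 : 0 ≤ (1 - RCLike.re c) • (|a| + a) :=
      smul_nonneg (by linarith) (by simpa using add_le_add (neg_le_abs a) (le_refl a))
    have h3 : 0 ≤ (1 + RCLike.re c) • (|a| - a) :=
      smul_nonneg (by linarith) (sub_nonneg.2 (le_abs_self a))
    have h4 : (1 - RCLike.re c) • (|a| + a) + (1 + RCLike.re c) • (|a| - a)
        = (2 : ℝ) • (|a| - RCLike.re c • a) := by module
    have h5 := add_nonneg h2 h3
    rw [h4] at h5
    have h6 := smul_nonneg (show (0 : ℝ) ≤ 1 / 2 by norm_num) h5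
    rw [smul_smul] at h6
    norm_num at h6
    exact h6
  have h2 : 0 ≤ m := by
    have e1 : a ≤ m := hm.1 ⟨1, by simp, by simp [L.re_incl]⟩
    have e2 : -a ≤ m := hm.1 ⟨-1, by simp, by rw [neg_smul, one_smul, map_neg, L.re_incl]⟩
    have e3 : |a| ≤ m := abs_le'.2 ⟨e1, e2⟩
    exact (abs_nonneg a).trans e3
  rwa [abs_of_nonneg h2]

theorem continuous_incl : Continuous L.incl :=
  (L.incl.mkContinuous 1 (by simpa using L.norm_incl_le)).continuous

theorem isClosed_cone : IsClosed L.cone := by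
  have h : L.cone = {x | 0 ≤ L.re x} ∩ {x | L.incl (L.re x) = x} :=
    Set.ext fun x => L.mem_cone_iff
  rw [h]
  exact (isClosed_le continuous_const L.continuous_re).inter
    (isClosed_eq (L.continuous_incl.comp L.continuous_re) continuous_id)

end BanachLatticeOver

/-! ### Continuity and growth of strongly continuous semigroups. -/

namespace C0Semigroup

variable {𝕜 X : Type*} [RCLike 𝕜] [NormedAddCommGroup X] [NormedSpace 𝕜 X]
  (T : C0Semigroup 𝕜 X)

/-- The semigroup, extended by the identity to negative times. -/
def ext (s : ℝ) : X →L[𝕜] X := T.op (max s 0)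

theorem ext_of_nonneg {s : ℝ} (hs : 0 ≤ s) : T.ext s = T.op s := by rw [ext, max_eq_left hs]

theorem ext_zero (x : X) : T.ext 0 x = x := by rw [T.ext_of_nonneg le_rfl, T.op_zero]; rfl

theorem op_op {s t : ℝ} (hs : 0 ≤ s) (ht : 0 ≤ t) (x : X) :
    T.op s (T.op t x) = T.op (s + t) x := by rw [T.op_add s t hs ht]; rfl

theorem op_ext {s t : ℝ} (hs : 0 ≤ s) (ht : 0 ≤ t) (x : X) :
    T.op s (T.ext t x) = T.ext (s + t) x := by
  rw [T.ext_of_nonneg ht, T.op_op hs ht, T.ext_of_nonneg (add_nonneg hs ht)]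

theorem continuous_ext (x : X) : Continuous fun s => T.ext s x :=
  (T.continuousOn x).comp_continuous (continuous_id.max continuous_const) fun s => Set.mem_Ici.2 (le_max_right s 0)

theorem exists_norm_ext_le [CompleteSpace X] (t : ℝ) :
    ∃ M : ℝ, 1 ≤ M ∧ ∀ s ≤ t, ‖T.ext s‖ ≤ M := by
  obtain ⟨C, hC⟩ := banach_steinhaus (g := fun s : Set.Icc (0 : ℝ) (max t 0) => T.op s)
    (fun x => by
      obtain ⟨C, hC⟩ := (isCompact_Icc (a := (0 : ℝ)) (b := max t 0)).exists_bound_of_continuousOn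
        ((T.continuousOn x).mono fun s hs => hs.1)
      exact ⟨C, fun s => hC s s.2⟩)
  exact ⟨max C 1, le_max_right _ _, fun s hs =>
    (hC ⟨max s 0, le_max_right _ _, max_le_max_right 0 hs⟩).trans (le_max_left _ _)⟩

/-- Strong continuity and local boundedness together give joint continuity, which is what makes
`T(t-s) B_lam u(s)` measurable in `s`. -/
theorem continuous_ext_uncurry [CompleteSpace X] :
    Continuous fun q : ℝ × X => T.ext q.1 q.2 := by
  rw [continuous_iff_continuousAt]
  rintro ⟨s₀, x₀⟩
  obtain ⟨M, -, hM⟩ := T.exists_norm_ext_le (s₀ + 1)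
  rw [ContinuousAt, tendsto_iff_norm_sub_tendsto_zero]
  have h1 : Tendsto (fun q : ℝ × X => M * ‖q.2 - x₀‖ + ‖T.ext q.1 x₀ - T.ext s₀ x₀‖)
      (𝓝 (s₀, x₀)) (𝓝 0) := by
    have hc : Continuous (fun q : ℝ × X => M * ‖q.2 - x₀‖ + ‖T.ext q.1 x₀ - T.ext s₀ x₀‖) := by
      have := (T.continuous_ext x₀).comp (continuous_fst (X := ℝ) (Y := X))
      simp only [Function.comp_def] at this
      fun_prop
    simpa using hc.tendsto (s₀, x₀)
  refine squeeze_zero' (Eventually.of_forall fun _ => norm_nonneg _) ?_ h1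
  have h2 : ∀ᶠ q : ℝ × X in 𝓝 (s₀, x₀), q.1 < s₀ + 1 :=
    (continuous_fst.tendsto (s₀, x₀)).eventually (Iio_mem_nhds (by simp))
  filter_upwards [h2] with q hq
  calc ‖T.ext q.1 q.2 - T.ext s₀ x₀‖
      = ‖T.ext q.1 (q.2 - x₀) + (T.ext q.1 x₀ - T.ext s₀ x₀)‖ := by rw [map_sub]; abel_nf
    _ ≤ ‖T.ext q.1 (q.2 - x₀)‖ + ‖T.ext q.1 x₀ - T.ext s₀ x₀‖ := norm_add_le _ _
    _ ≤ _ := by gcongr; exact (T.ext q.1).le_of_opNorm_le (hM _ hq.le) _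

theorem exists_growth [CompleteSpace X] :
    ∃ ω M : ℝ, ∀ t : ℝ, 0 ≤ t → ‖T.op t‖ ≤ M * Real.exp (ω * t) := by
  obtain ⟨M, hM1, hM⟩ := T.exists_norm_ext_le 1
  have h0 : 0 < M := by linarith
  have key : ∀ n : ℕ, ∀ t : ℝ, 0 ≤ t → t ≤ n + 1 → ‖T.op t‖ ≤ M * M ^ n := by
    intro n
    induction n with
    | zero =>
      intro t ht ht1
      rw [← T.ext_of_nonneg ht]
      simpa using hM t (by simpa using ht1)
    | succ n ih =>
      intro t ht htn
      by_cases h : t ≤ n + 1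
      · exact (ih t ht h).trans (by gcongr; simp)
      · push Not at h
        have h1 : 0 ≤ t - 1 := by have : (0 : ℝ) ≤ n := n.cast_nonneg
                                  linarith
        have e : T.op t = (T.op 1).comp (T.op (t - 1)) := by
          rw [← T.op_add 1 (t - 1) zero_le_one h1]; congr 1; ring
        rw [e]
        calc _ ≤ ‖T.op 1‖ * ‖T.op (t - 1)‖ := ContinuousLinearMap.opNorm_comp_le _ _
          _ ≤ M * (M * M ^ n) := by
            gcongr
            · rw [← T.ext_of_nonneg zero_le_one]; exact hM 1 le_rfl
            · exact ih _ h1 (by push_cast at htn; linarith)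
          _ = _ := by ring
  -- Since `M ≥ 1`, the power `M ^ ⌊t⌋₊` is at most `exp (t log M)`.
  refine ⟨Real.log M, M, fun t ht => (key ⌊t⌋₊ t ht (Nat.lt_floor_add_one t).le).trans ?_⟩
  gcongr
  rw [← Real.rpow_natCast, Real.rpow_def_of_pos h0]
  gcongr
  · exact Real.log_nonneg hM1
  · exact Nat.floor_le ht

theorem exists_bound_of_growthBound_lt {lam : ℝ} (h : T.growthBound < (lam : EReal)) :
    ∃ ω M : ℝ, ω < lam ∧ ∀ t : ℝ, 0 ≤ t → ‖T.op t‖ ≤ M * Real.exp (ω * t) := by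
  obtain ⟨_, ⟨ω, rfl, M, hM⟩, hw⟩ := sInf_lt_iff.1 h
  exact ⟨ω, M, EReal.coe_lt_coe_iff.1 hw, hM⟩

theorem growthBound_le {ω M : ℝ} (h : ∀ t : ℝ, 0 ≤ t → ‖T.op t‖ ≤ M * Real.exp (ω * t)) :
    T.growthBound ≤ (ω : EReal) := sInf_le ⟨ω, rfl, M, h⟩

theorem exists_growthBound_lt [CompleteSpace X] : ∃ lam : ℝ, T.growthBound < (lam : EReal) := by
  obtain ⟨ω, M, h⟩ := T.exists_growth
  exact ⟨ω + 1, (T.growthBound_le h).trans_lt (EReal.coe_lt_coe_iff.2 (by linarith))⟩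

/-! ### The generator, primitives of orbits, and the Laplace transform. -/

section Generator

variable [NormedSpace ℝ X]

/-- The graph of the infinitesimal generator. -/
def Gen (x y : X) : Prop := Tendsto (fun h : ℝ => h⁻¹ • (T.op h x - x)) (𝓝[>] 0) (𝓝 y)

variable {T}

theorem Gen.unique {x y z : X} (h : T.Gen x y) (h' : T.Gen x z) : y = z := tendsto_nhds_unique h h'

theorem Gen.add {x y x' y' : X} (h : T.Gen x y) (h' : T.Gen x' y') : T.Gen (x + x') (y + y') := by
  refine (Tendsto.add h h').congr fun s => ?_
  rw [← smul_add, map_add]; congr 1; abel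

theorem Gen.smul [IsScalarTower ℝ 𝕜 X] {x y : X} (c : 𝕜) (h : T.Gen x y) :
    T.Gen (c • x) (c • y) := by
  refine (Tendsto.const_smul h c).congr fun s => ?_
  rw [map_smul, ← smul_sub, smul_comm]

theorem Gen.map [IsScalarTower ℝ 𝕜 X] {x y : X} (h : T.Gen x y) {R : X →L[𝕜] X}
    (hR : ∀ s, 0 ≤ s → ∀ x, R (T.op s x) = T.op s (R x)) : T.Gen (R x) (R y) := by
  refine ((R.continuous.tendsto y).comp h).congr' ?_
  filter_upwards [self_mem_nhdsWithin] with s hs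
  simp only [Function.comp_apply]
  rw [ContinuousLinearMap.map_smul_of_tower, map_sub, hR s (le_of_lt hs)]

theorem Gen.op [IsScalarTower ℝ 𝕜 X] {x y : X} (h : T.Gen x y) {s : ℝ} (hs : 0 ≤ s) :
    T.Gen (T.op s x) (T.op s y) :=
  h.map fun r hr z => by rw [T.op_op hs hr, T.op_op hr hs, add_comm]

variable (T)

/-- Applying `T(h)` shifts the window of integration to `[α - h, β - h]` and produces a factor `exp
(lam h)`. The generator is thus read off from the product rule and the fundamental theorem of
calculus at `h = 0`. -/
theorem gen_integral [IsScalarTower ℝ 𝕜 X] [CompleteSpace X] (x : X) (lam : ℝ) {α β t : ℝ}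
    (hαβ : α ≤ β) (hβ : β ≤ t) :
    T.Gen (∫ s in α..β, Real.exp (lam * s) • T.ext (t - s) x)
      (lam • (∫ s in α..β, Real.exp (lam * s) • T.ext (t - s) x) -
        (Real.exp (lam * β) • T.ext (t - β) x - Real.exp (lam * α) • T.ext (t - α) x)) := by
  set F : ℝ → X := fun s => Real.exp (lam * s) • T.ext (t - s) x with hF
  have hFc : Continuous F :=
    (by fun_prop : Continuous fun s : ℝ => Real.exp (lam * s)).smul
      ((T.continuous_ext x).comp (continuous_const.sub continuous_id))
  have hd : HasDerivAt (fun h : ℝ => Real.exp (lam * h) • ∫ s in (α - h)..(β - h), F s)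
      (lam • (∫ s in α..β, F s) - (F β - F α)) 0 := by
    have h1 : ∀ r, HasDerivAt (fun h : ℝ => ∫ s in (0 : ℝ)..(r - h), F s) (-F r) 0 := by
      intro r
      have h2 : HasDerivAt (fun u => ∫ s in (0 : ℝ)..u, F s) (F (r - 0)) (r - 0) :=
        hFc.integral_hasStrictDerivAt 0 (r - 0) |>.hasDerivAt
      have h3 : HasDerivAt (fun h : ℝ => r - h) (-1) 0 := (hasDerivAt_id (0 : ℝ)).const_sub r
      simpa [Function.comp_def] using h2.scomp 0 h3
    have h4 : HasDerivAt (fun h : ℝ => ∫ s in (α - h)..(β - h), F s) (-F β - -F α) 0 := by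
      refine ((h1 β).sub (h1 α)).congr_of_eventuallyEq (Eventually.of_forall fun h => ?_)
      exact (intervalIntegral.integral_interval_sub_left (hFc.intervalIntegrable _ _)
        (hFc.intervalIntegrable _ _)).symm
    have h5 : HasDerivAt (fun h : ℝ => Real.exp (lam * h)) lam 0 := by
      simpa using ((hasDerivAt_id (0 : ℝ)).const_mul lam).exp
    convert h5.smul h4 using 1
    · rfl
    · simp only [mul_zero, Real.exp_zero, sub_zero, one_smul]
      abel
  refine (hd.tendsto_slope_zero_right).congr' ?_
  filter_upwards [self_mem_nhdsWithin] with h hh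
  have hh' : 0 ≤ h := le_of_lt hh
  congr 1
  simp only [zero_add, mul_zero, Real.exp_zero, sub_zero, one_smul]
  congr 1
  rw [← ContinuousLinearMap.intervalIntegral_comp_comm _ (hFc.intervalIntegrable _ _),
    ← intervalIntegral.integral_comp_sub_right, ← intervalIntegral.integral_smul]
  refine intervalIntegral.integral_congr fun s hs => ?_
  rw [Set.uIcc_of_le hαβ] at hs
  simp only [hF]
  rw [ContinuousLinearMap.map_smul_of_tower, T.op_ext hh' (by linarith [hs.2]), smul_smul, ← Real.exp_add]
  rw [show lam * h + lam * (s - h) = lam * s by ring, show t - (s - h) = h + (t - s) by ring]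

theorem integrableOn_laplace {ω M lam : ℝ}
    (hM : ∀ t : ℝ, 0 ≤ t → ‖T.op t‖ ≤ M * Real.exp (ω * t)) (hlam : ω < lam) (x : X) :
    IntegrableOn (fun s => Real.exp (-(lam * s)) • T.ext s x) (Set.Ioi 0) := by
  have h1 : IntegrableOn (fun s : ℝ => M * ‖x‖ * Real.exp ((ω - lam) * s)) (Set.Ioi 0) :=
    (integrableOn_exp_mul_Ioi (by linarith) 0).const_mul _
  refine Integrable.mono' h1 ?_ ?_
  · exact ((by fun_prop : Continuous fun s : ℝ => Real.exp (-(lam * s))).smul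
      (T.continuous_ext x)).aestronglyMeasurable
  · filter_upwards [ae_restrict_mem measurableSet_Ioi] with s hs
    have hs' : 0 ≤ s := le_of_lt hs
    rw [norm_smul, Real.norm_eq_abs, Real.abs_exp, T.ext_of_nonneg hs']
    calc _ ≤ Real.exp (-(lam * s)) * (M * Real.exp (ω * s) * ‖x‖) := by
          gcongr
          exact (T.op s).le_of_opNorm_le (hM s hs') x
      _ = M * ‖x‖ * (Real.exp (-(lam * s)) * Real.exp (ω * s)) := by ring
      _ = _ := by rw [← Real.exp_add]; congr 2; ring

/-- The resolvent of the generator as the Laplace transform of the semigroup. -/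
theorem exists_laplace [IsScalarTower ℝ 𝕜 X] [CompleteSpace X] {ω M lam : ℝ}
    (hM : ∀ t : ℝ, 0 ≤ t → ‖T.op t‖ ≤ M * Real.exp (ω * t)) (hlam : ω < lam) :
    ∃ R : X →L[𝕜] X, (∀ x, R x = ∫ s in Set.Ioi (0 : ℝ), Real.exp (-(lam * s)) • T.ext s x) ∧
      (∀ x, T.Gen (R x) (lam • R x - x)) ∧
      (∀ x y, T.Gen x y → R y = lam • R x - x) ∧ ‖R‖ ≤ M / (lam - ω) := by
  have hint := T.integrableOn_laplace hM hlam
  have hM0 : 0 ≤ M := by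
    have := (norm_nonneg _).trans (hM 0 le_rfl)
    simpa using this
  let R : X →L[𝕜] X := LinearMap.mkContinuous
    { toFun := fun x => ∫ s in Set.Ioi (0 : ℝ), Real.exp (-(lam * s)) • T.ext s x
      map_add' := fun x y => by
        rw [← integral_add (hint x) (hint y)]
        simp only [map_add, smul_add]
      map_smul' := fun c x => by
        rw [RingHom.id_apply, ← integral_smul]
        simp only [map_smul]
        exact integral_congr_ae (Eventually.of_forall fun s => smul_comm _ _ _) }
    (M / (lam - ω)) (fun x => by
      have h1 : IntegrableOn (fun s : ℝ => M * ‖x‖ * Real.exp ((ω - lam) * s)) (Set.Ioi 0) :=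
        (integrableOn_exp_mul_Ioi (by linarith) 0).const_mul _
      refine (norm_integral_le_of_norm_le h1 ?_).trans (le_of_eq ?_)
      · filter_upwards [ae_restrict_mem measurableSet_Ioi] with s hs
        have hs' : 0 ≤ s := le_of_lt hs
        rw [norm_smul, Real.norm_eq_abs, Real.abs_exp, T.ext_of_nonneg hs']
        calc _ ≤ Real.exp (-(lam * s)) * (M * Real.exp (ω * s) * ‖x‖) := by
              gcongr
              exact (T.op s).le_of_opNorm_le (hM s hs') x
          _ = M * ‖x‖ * (Real.exp (-(lam * s)) * Real.exp (ω * s)) := by ring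
          _ = _ := by rw [← Real.exp_add]; congr 2; ring
      · rw [integral_const_mul, integral_exp_mul_Ioi (by linarith)]
        have : lam - ω ≠ 0 := by linarith
        have : ω - lam ≠ 0 := by linarith
        simp
        field_simp
        ring)
  have hR : ∀ x, R x = ∫ s in Set.Ioi (0 : ℝ), Real.exp (-(lam * s)) • T.ext s x := fun x => rfl
  have hcomm : ∀ h, 0 ≤ h → ∀ x, R (T.op h x) = T.op h (R x) := by
    intro h hh x
    rw [hR, hR, ← ContinuousLinearMap.integral_comp_comm _ (hint x)]
    refine setIntegral_congr_fun measurableSet_Ioi fun s hs => ?_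
    have hs' : 0 ≤ s := le_of_lt hs
    rw [ContinuousLinearMap.map_smul_of_tower, T.ext_of_nonneg hs', T.op_op hh hs',
      T.op_op hs' hh, add_comm]
  have hgen : ∀ x, T.Gen (R x) (lam • R x - x) := by
    intro x
    set G : ℝ → X := fun s => Real.exp (-(lam * s)) • T.ext s x with hG
    have hGc : Continuous G := (by fun_prop : Continuous fun s : ℝ => Real.exp (-(lam * s))).smul
      (T.continuous_ext x)
    -- For `h ≥ 0` this function equals `T(h) (R x)`, by shifting the Laplace integral.
    have hd : HasDerivAt (fun h : ℝ => Real.exp (lam * h) • (R x - ∫ s in (0 : ℝ)..h, G s))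
        (lam • R x - x) 0 := by
      have h2 : HasDerivAt (fun u => ∫ s in (0 : ℝ)..u, G s) (G 0) 0 :=
        hGc.integral_hasStrictDerivAt 0 0 |>.hasDerivAt
      have h5 : HasDerivAt (fun h : ℝ => Real.exp (lam * h)) lam 0 := by
        simpa using ((hasDerivAt_id (0 : ℝ)).const_mul lam).exp
      convert h5.smul (h2.const_sub (R x)) using 1
      · rfl
      · simp only [hG, mul_zero, Real.exp_zero, neg_zero, one_smul, T.ext_zero,
          intervalIntegral.integral_same, sub_zero]
        abel
    refine (hd.tendsto_slope_zero_right).congr' ?_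
    filter_upwards [self_mem_nhdsWithin] with h hh
    have hh' : 0 ≤ h := le_of_lt hh
    congr 1
    simp only [zero_add, mul_zero, Real.exp_zero, sub_zero, one_smul,
      intervalIntegral.integral_same]
    congr 1
    have e1 : R x - ∫ s in (0 : ℝ)..h, G s = ∫ s in Set.Ioi h, G s := by
      rw [hR, sub_eq_iff_eq_add', ← intervalIntegral.integral_interval_add_Ioi (hint x)
        ((hint x).mono_set (Set.Ioi_subset_Ioi hh'))]
    have e2 : ∫ s in Set.Ioi h, G s = ∫ s in Set.Ioi (0 : ℝ), G (s + h) := by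
      rw [← (measurePreserving_add_right volume h).setIntegral_preimage_emb
        (measurableEmbedding_addRight h) G (Set.Ioi h)]
      simp
    rw [e1, e2, hR, ← ContinuousLinearMap.integral_comp_comm _ (hint x), ← integral_smul]
    refine setIntegral_congr_fun measurableSet_Ioi fun s hs => ?_
    have hs' : 0 ≤ s := le_of_lt hs
    simp only [hG]
    rw [ContinuousLinearMap.map_smul_of_tower, T.op_ext hh' hs', smul_smul, ← Real.exp_add,
      show lam * h + -(lam * (s + h)) = -(lam * s) by ring, add_comm s h]
  exact ⟨R, hR, hgen, fun x y hxy => (hxy.map hcomm).unique (hgen x),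
    LinearMap.mkContinuous_norm_le _ (div_nonneg hM0 (by linarith)) _⟩

end Generator

end C0Semigroup

/-! ### Dirichlet operators and independence of the resolvent point. -/

namespace BoundaryControlSystem

variable {𝕜 X Y U : Type*} [RCLike 𝕜]
    [NormedAddCommGroup X] [NormedSpace ℝ X] [NormedSpace 𝕜 X]
    [NormedAddCommGroup Y] [NormedSpace 𝕜 Y]
    [NormedAddCommGroup U] [NormedSpace 𝕜 U]
    (S : BoundaryControlSystem 𝕜 X Y U)

theorem gen_iff {x y : X} : (∃ h : x ∈ S.A.domain, S.A ⟨x, h⟩ = y) ↔ S.T.Gen x y :=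
  S.T_generator x y

/-- Working with the graph relation `Gen` avoids carrying proofs of domain membership. -/
theorem mem_resolventSetOf_iff {lam : 𝕜} : lam ∈ resolventSetOf S.A ↔
    ∃ R : X →L[𝕜] X, (∀ x, S.T.Gen (R x) (lam • R x - x)) ∧
      ∀ x y, S.T.Gen x y → R (lam • x - y) = x := by
  constructor
  · rintro ⟨R, h1, h2⟩
    refine ⟨R, fun x => ?_, fun x y hxy => ?_⟩
    · obtain ⟨h, e⟩ := h1 x
      refine S.gen_iff.1 ⟨h, ?_⟩
      nth_rw 3 [← e]
      abel
    · obtain ⟨h, rfl⟩ := S.gen_iff.2 hxy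
      exact h2 ⟨x, h⟩
  · rintro ⟨R, h1, h2⟩
    refine ⟨R, fun x => ?_, fun x => h2 _ _ (S.gen_iff.1 ⟨x.2, rfl⟩)⟩
    obtain ⟨h, e⟩ := S.gen_iff.2 (h1 x)
    exact ⟨h, by rw [e]; abel⟩

theorem isControlValue_iff {lam : 𝕜} (hlam : lam ∈ resolventSetOf S.A) (t : ℝ) (u : ℝ → U)
    (x : X) : S.IsControlValue hlam t u x ↔
      S.T.Gen (S.controlIntegral hlam t u) (lam • S.controlIntegral hlam t u - x) := by
  rw [← S.gen_iff]
  exact exists_congr fun h => ⟨fun e => by rw [e]; abel, fun e => by rw [e]; abel⟩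

theorem dirichlet_spec {lam : 𝕜} (hlam : lam ∈ resolventSetOf S.A) (y : Y) :
    ∃ h : S.dirichlet hlam y ∈ S.Am.domain, S.Q ⟨_, h⟩ = y ∧
      S.Am ⟨_, h⟩ = lam • S.dirichlet hlam y := by
  set z := (LinearEquiv.ofBijective _ (S.Q_bijective hlam)).symm y with hz
  refine ⟨z.1.2, ?_, ?_⟩
  · exact (LinearEquiv.ofBijective _ (S.Q_bijective hlam)).apply_symm_apply y
  · have : lam • (z.1 : X) - S.Am z.1 = 0 := z.2
    exact (sub_eq_zero.1 this).symm

theorem dirichlet_eq_of {lam : 𝕜} (hlam : lam ∈ resolventSetOf S.A) {y : Y} {x : X}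
    (h : x ∈ S.Am.domain) (hQ : S.Q ⟨x, h⟩ = y) (hA : S.Am ⟨x, h⟩ = lam • x) :
    S.dirichlet hlam y = x := by
  let z : S.eigenspace lam := ⟨⟨x, h⟩, by
    change lam • x - S.Am ⟨x, h⟩ = 0
    rw [hA, sub_self]⟩
  have : (LinearEquiv.ofBijective _ (S.Q_bijective hlam)).symm y = z := by
    rw [LinearEquiv.symm_apply_eq]
    exact hQ.symm
  change (((LinearEquiv.ofBijective _ (S.Q_bijective hlam)).symm y : S.Am.domain) : X) = x
  rw [this]

/-- Closed graph theorem: closedness of `Am` puts the limit in `ker (lam - Am)`, and the graph-norm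
bound on `Q` identifies its boundary value. -/
theorem continuous_dirichlet [CompleteSpace X] [CompleteSpace Y] {lam : 𝕜}
    (hlam : lam ∈ resolventSetOf S.A) : Continuous (S.dirichlet hlam) := by
  refine LinearMap.continuous_of_seq_closed_graph _ fun u y x hu hx => ?_
  choose hd hQ hA using fun n => S.dirichlet_spec hlam (u n)
  have hx' : Tendsto (fun n => S.dirichlet hlam (u n)) atTop (𝓝 x) := hx
  have hmem : (x, lam • x) ∈ S.Am.graph := by
    refine S.Am_closed.mem_of_tendsto (hx'.prodMk_nhds (hx'.const_smul lam))
      (Eventually.of_forall fun n => ?_)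
    rw [SetLike.mem_coe, LinearPMap.mem_graph_iff]
    exact ⟨⟨_, hd n⟩, rfl, hA n⟩
  rw [LinearPMap.mem_graph_iff] at hmem
  obtain ⟨⟨x', h⟩, rfl, hAx⟩ := hmem
  refine (S.dirichlet_eq_of hlam h ?_ hAx).symm
  obtain ⟨C, hC⟩ := S.Q_bounded
  have hlim : Tendsto (fun n => S.Q ⟨_, hd n⟩) atTop (𝓝 (S.Q ⟨x', h⟩)) := by
    rw [tendsto_iff_norm_sub_tendsto_zero]
    have h1 : Tendsto (fun n => C * (‖S.dirichlet hlam (u n) - x'‖ +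
        ‖lam • (S.dirichlet hlam (u n) - x')‖)) atTop (𝓝 0) := by
      have h2 := (hx'.sub_const x')
      have := (h2.norm.add (h2.const_smul lam).norm).const_mul C
      simpa using this
    refine squeeze_zero (fun _ => norm_nonneg _) (fun n => ?_) h1
    have := hC (⟨_, hd n⟩ - ⟨x', h⟩)
    rw [map_sub, LinearPMap.map_sub, hA n, hAx, ← smul_sub] at this
    exact this
  simp only [hQ] at hlim
  exact tendsto_nhds_unique hlim hu

/-- The operator `B_lam` as a bounded operator. -/
noncomputable def BopL [CompleteSpace X] [CompleteSpace Y] {lam : 𝕜}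
    (hlam : lam ∈ resolventSetOf S.A) : U →L[𝕜] X :=
  ⟨S.Bop hlam, (S.continuous_dirichlet hlam).comp S.B.continuous⟩

theorem BopL_apply [CompleteSpace X] [CompleteSpace Y] {lam : 𝕜}
    (hlam : lam ∈ resolventSetOf S.A) (v : U) : S.BopL hlam v = S.Bop hlam v := rfl

/-- Both Dirichlet solutions have boundary value `B v`, so their difference lies in `ker Q`, where
`Am` acts as the generator. -/
theorem gen_Bop_sub {lam μ : 𝕜} (hlam : lam ∈ resolventSetOf S.A) (hμ : μ ∈ resolventSetOf S.A)
    (v : U) : S.T.Gen (S.Bop hlam v - S.Bop hμ v) (lam • S.Bop hlam v - μ • S.Bop hμ v) := by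
  obtain ⟨h1, hQ1, hA1⟩ := S.dirichlet_spec hlam (S.B v)
  obtain ⟨h2, hQ2, hA2⟩ := S.dirichlet_spec hμ (S.B v)
  have hQ : S.Q (⟨_, h1⟩ - ⟨_, h2⟩) = 0 := by rw [map_sub, hQ1, hQ2, sub_self]
  refine S.gen_iff.1 ⟨S.mem_A_domain _ hQ, ?_⟩
  have := S.A_apply _ (S.mem_A_domain _ hQ)
  refine this.trans ?_
  change S.Am (⟨_, h1⟩ - ⟨_, h2⟩) = _
  rw [LinearPMap.map_sub, hA1, hA2]
  rfl

theorem Bop_eq_add {lam μ : 𝕜} (hlam : lam ∈ resolventSetOf S.A) (hμ : μ ∈ resolventSetOf S.A)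
    {R : X →L[𝕜] X} (hR : ∀ x y, S.T.Gen x y → R (lam • x - y) = x) (v : U) :
    S.Bop hlam v = S.Bop hμ v + (μ - lam) • R (S.Bop hμ v) := by
  have := hR _ _ (S.gen_Bop_sub hlam hμ v)
  have e : lam • (S.Bop hlam v - S.Bop hμ v) - (lam • S.Bop hlam v - μ • S.Bop hμ v) =
      (μ - lam) • S.Bop hμ v := by module
  rw [e, map_smul] at this
  rw [this, add_sub_cancel]

section

theorem resolvent_op [IsScalarTower ℝ 𝕜 X] {lam : 𝕜} {R : X →L[𝕜] X} (h1 : ∀ x, S.T.Gen (R x) (lam • R x - x))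
    (h2 : ∀ x y, S.T.Gen x y → R (lam • x - y) = x) {s : ℝ} (hs : 0 ≤ s) (x : X) :
    R (S.T.op s x) = S.T.op s (R x) := by
  have := h2 _ _ ((h1 x).op hs)
  rwa [← map_smul, ← map_sub, sub_sub_cancel] at this

variable [CompleteSpace X] [CompleteSpace Y]

theorem controlIntegral_eq {lam : 𝕜} (hlam : lam ∈ resolventSetOf S.A) {t : ℝ} (ht : 0 ≤ t)
    (u : ℝ → U) : S.controlIntegral hlam t u =
      ∫ s, S.T.ext (t - s) (S.BopL hlam (u s)) ∂(volume.restrict (Set.Icc 0 t)) := by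
  rw [controlIntegral, intervalIntegral.integral_of_le ht, ← integral_Icc_eq_integral_Ioc]
  refine setIntegral_congr_fun measurableSet_Icc fun s hs => ?_
  rw [S.T.ext_of_nonneg (sub_nonneg.2 hs.2), BopL_apply]

theorem integrable_ext_Bop {lam : 𝕜} (hlam : lam ∈ resolventSetOf S.A) {t : ℝ} {u : ℝ → U}
    (hu : Integrable u (volume.restrict (Set.Icc 0 t))) :
    Integrable (fun s => S.T.ext (t - s) (S.BopL hlam (u s))) (volume.restrict (Set.Icc 0 t)) := by
  obtain ⟨M, hM1, hM⟩ := S.T.exists_norm_ext_le t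
  refine Integrable.mono' ((hu.norm.const_mul ‖S.BopL hlam‖).const_mul M) ?_ ?_
  · exact S.T.continuous_ext_uncurry.comp_aestronglyMeasurable
      ((by fun_prop : Continuous fun s : ℝ => t - s).aestronglyMeasurable.prodMk
        ((S.BopL hlam).continuous.comp_aestronglyMeasurable hu.aestronglyMeasurable))
  · filter_upwards [ae_restrict_mem measurableSet_Icc] with s hs
    exact ((S.T.ext (t - s)).le_of_opNorm_le (hM _ (by linarith [hs.1])) _).trans
      (by gcongr; exact (S.BopL hlam).le_opNorm _)

/-- The resolvent commutes with the semigroup, so `Bop_eq_add` passes through the integral: changing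
the resolvent point adds a term in the domain of `A`, and `lam - A` absorbs it. -/
theorem isControlValue_of [IsScalarTower ℝ 𝕜 X] {lam μ : 𝕜} (hlam : lam ∈ resolventSetOf S.A)
    (hμ : μ ∈ resolventSetOf S.A) {t : ℝ} (ht : 0 ≤ t) {u : ℝ → U}
    (hu : Integrable u (volume.restrict (Set.Icc 0 t))) {x : X}
    (h : S.IsControlValue hμ t u x) : S.IsControlValue hlam t u x := by
  rw [isControlValue_iff] at h ⊢
  obtain ⟨R, h1, h2⟩ := S.mem_resolventSetOf_iff.1 hlam
  have hint := S.integrable_ext_Bop hμ hu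
  have e : S.controlIntegral hlam t u =
      S.controlIntegral hμ t u + (μ - lam) • R (S.controlIntegral hμ t u) := by
    rw [S.controlIntegral_eq hlam ht, S.controlIntegral_eq hμ ht,
      ← ContinuousLinearMap.integral_comp_comm R hint, ← integral_smul,
      ← integral_add (g := fun s => (μ - lam) • R (S.T.ext (t - s) (S.BopL hμ (u s)))) hint
        ((R.integrable_comp hint).smul (μ - lam))]
    refine setIntegral_congr_fun measurableSet_Icc fun s hs => ?_
    have hs' : 0 ≤ t - s := sub_nonneg.2 hs.2
    rw [S.T.ext_of_nonneg hs', S.resolvent_op h1 h2 hs', BopL_apply, BopL_apply,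
      S.Bop_eq_add hlam hμ h2, map_add, map_smul]
  have h3 := h.add ((h1 (S.controlIntegral hμ t u)).smul (μ - lam))
  rw [← e] at h3
  convert h3 using 1
  rw [e]
  module

theorem isControlValue_congr [IsScalarTower ℝ 𝕜 X] {lam μ : 𝕜} (hlam : lam ∈ resolventSetOf S.A)
    (hμ : μ ∈ resolventSetOf S.A) {t : ℝ} (ht : 0 ≤ t) {u : ℝ → U}
    (hu : Integrable u (volume.restrict (Set.Icc 0 t))) {x : X} :
    S.IsControlValue hμ t u x ↔ S.IsControlValue hlam t u x :=
  ⟨S.isControlValue_of hlam hμ ht hu, S.isControlValue_of hμ hlam ht hu⟩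

end

end BoundaryControlSystem

/-! ### Admissibility at one time implies admissibility at every time. -/

namespace BoundaryControlSystem

variable {𝕜 X Y U : Type*} [RCLike 𝕜]
    [NormedAddCommGroup X] [NormedSpace ℝ X] [NormedSpace 𝕜 X] [CompleteSpace X]
    [NormedAddCommGroup Y] [NormedSpace 𝕜 Y] [CompleteSpace Y]
    [NormedAddCommGroup U] [NormedSpace 𝕜 U]
    (S : BoundaryControlSystem 𝕜 X Y U)

theorem controlIntegral_eq_intervalIntegral {lam : 𝕜} (hlam : lam ∈ resolventSetOf S.A) {t : ℝ}
    (ht : 0 ≤ t) (u : ℝ → U) : S.controlIntegral hlam t u =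
      ∫ s in (0 : ℝ)..t, S.T.ext (t - s) (S.BopL hlam (u s)) := by
  rw [S.controlIntegral_eq hlam ht, intervalIntegral.integral_of_le ht,
    ← integral_Icc_eq_integral_Ioc]

theorem controlIntegral_congr {lam : 𝕜} (hlam : lam ∈ resolventSetOf S.A) {t : ℝ}
    (ht : 0 ≤ t) {u w : ℝ → U} (h : u =ᵐ[volume.restrict (Set.Icc 0 t)] w) :
    S.controlIntegral hlam t u = S.controlIntegral hlam t w := by
  rw [S.controlIntegral_eq hlam ht, S.controlIntegral_eq hlam ht]
  exact integral_congr_ae (h.mono fun s hs => by simp only [hs])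

omit [CompleteSpace X] [CompleteSpace Y] in
theorem controlIntegral_zero {lam : 𝕜} (hlam : lam ∈ resolventSetOf S.A) (t : ℝ) :
    S.controlIntegral hlam t 0 = 0 := by
  simp [controlIntegral]

/-- Cocycle identity: the input up to time `a` is transported by `T(b)`, and the later input acts
after a time shift. -/
theorem controlIntegral_add_time {lam : 𝕜} (hlam : lam ∈ resolventSetOf S.A) {a b : ℝ}
    (ha : 0 ≤ a) (hb : 0 ≤ b) {u : ℝ → U}
    (hu : Integrable u (volume.restrict (Set.Icc 0 (a + b)))) :
    S.controlIntegral hlam (a + b) u = S.T.op b (S.controlIntegral hlam a u) +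
      S.controlIntegral hlam b (fun s => u (s + a)) := by
  have hint : IntervalIntegrable (fun s => S.T.ext (a + b - s) (S.BopL hlam (u s))) volume 0 (a + b) := by
    rw [intervalIntegrable_iff_integrableOn_Icc_of_le (by positivity)]
    exact S.integrable_ext_Bop hlam hu
  have hua : Integrable u (volume.restrict (Set.Icc 0 a)) :=
    hu.mono_measure (Measure.restrict_mono (Set.Icc_subset_Icc_right (by linarith)) le_rfl)
  rw [S.controlIntegral_eq_intervalIntegral hlam (add_nonneg ha hb),
    S.controlIntegral_eq_intervalIntegral hlam hb,
    S.controlIntegral_eq hlam ha, ← ContinuousLinearMap.integral_comp_comm _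
      (S.integrable_ext_Bop hlam hua), integral_Icc_eq_integral_Ioc,
      ← intervalIntegral.integral_of_le ha,
    ← intervalIntegral.integral_add_adjacent_intervals (b := a)
      (hint.mono_set (by rw [Set.uIcc_of_le ha, Set.uIcc_of_le (by positivity)]
                         exact Set.Icc_subset_Icc_right (by linarith)))
      (hint.mono_set (by rw [Set.uIcc_of_le (by linarith), Set.uIcc_of_le (by positivity)]
                         exact Set.Icc_subset_Icc_left ha))]
  congr 1
  · refine intervalIntegral.integral_congr fun s hs => ?_
    rw [Set.uIcc_of_le ha] at hs
    rw [S.T.op_ext hb (sub_nonneg.2 hs.2)]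
    congr 2
    ring
  · have := intervalIntegral.integral_comp_add_right (a := 0) (b := b)
      (fun s => S.T.ext (a + b - s) (S.BopL hlam (u s))) a
    rw [zero_add, add_comm b a] at this
    rw [← this]
    refine intervalIntegral.integral_congr fun s hs => ?_
    congr 2
    ring

theorem memLp_comp_add_right {p : ENNReal} {a b : ℝ} {u : ℝ → U}
    (hu : MemLp u p (volume.restrict (Set.Icc a (a + b)))) :
    MemLp (fun s => u (s + a)) p (volume.restrict (Set.Icc 0 b)) := by
  have h := (measurePreserving_add_right volume a).restrict_preimage
    (measurableSet_Icc (a := a) (b := a + b))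
  have e : (fun s => s + a) ⁻¹' Set.Icc a (a + b) = Set.Icc 0 b := by
    rw [Set.preimage_add_const_Icc]; simp
  rw [e] at h
  exact hu.comp_measurePreserving h

variable [IsScalarTower ℝ 𝕜 X]

theorem exists_gen_controlIntegral {p : ENNReal} (hp : 1 ≤ p) (hB : S.IsAdmissible p) :
    ∃ (lam : 𝕜) (hlam : lam ∈ resolventSetOf S.A), ∀ t : ℝ, 0 ≤ t → ∀ u : ℝ → U,
      MemLp u p (volume.restrict (Set.Icc 0 t)) → ∃ y, S.T.Gen (S.controlIntegral hlam t u) y := by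
  obtain ⟨t₀, ht₀, lam, hlam, H⟩ := hB
  refine ⟨lam, hlam, ?_⟩
  have hmul : ∀ n : ℕ, ∀ u : ℝ → U, MemLp u p (volume.restrict (Set.Icc 0 (n * t₀ + t₀))) →
      ∃ y, S.T.Gen (S.controlIntegral hlam (n * t₀ + t₀) u) y := by
    intro n
    induction n with
    | zero =>
      intro u hu
      simp only [Nat.cast_zero, zero_mul, zero_add] at hu ⊢
      exact ⟨_, S.gen_iff.1 ⟨H u hu, rfl⟩⟩
    | succ n ih =>
      intro u hu
      rw [Nat.cast_succ, add_one_mul] at hu ⊢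
      have hn : (0 : ℝ) ≤ n * t₀ + t₀ := by positivity
      rw [S.controlIntegral_add_time hlam hn ht₀.le (hu.integrable hp)]
      obtain ⟨y, hy⟩ := ih u
        (hu.mono_measure (Measure.restrict_mono (Set.Icc_subset_Icc_right (by linarith)) le_rfl))
      have hw := memLp_comp_add_right
        (hu.mono_measure (Measure.restrict_mono (Set.Icc_subset_Icc_left hn) le_rfl))
      exact ⟨_, (hy.op ht₀.le).add (S.gen_iff.1 ⟨H _ hw, rfl⟩)⟩
  intro t ht w hw
  obtain ⟨n, hn⟩ := exists_nat_ge (t / t₀)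
  rw [div_le_iff₀ ht₀] at hn
  obtain ⟨d, hd⟩ : ∃ d, d = n * t₀ + t₀ - t := ⟨_, rfl⟩
  have hd0 : 0 ≤ d := by linarith
  have htd : n * t₀ + t₀ = d + t := by linarith
  -- Delaying `w` by `d`, with zero input before, turns time `t` into a multiple of `t₀` without
  -- changing the control integral.
  set u : ℝ → U := (Set.Ioi d).indicator fun s => w (s - d) with hu
  have huL : MemLp u p (volume.restrict (Set.Icc 0 (d + t))) := by
    rw [hu, memLp_indicator_iff_restrict measurableSet_Ioi,
      Measure.restrict_restrict measurableSet_Ioi]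
    have h := (measurePreserving_sub_right volume d).restrict_preimage
      (measurableSet_Icc (a := (0 : ℝ)) (b := t))
    have e : (fun s => s - d) ⁻¹' Set.Icc 0 t = Set.Icc d (d + t) := by
      rw [Set.preimage_sub_const_Icc, zero_add, add_comm]
    rw [e] at h
    refine (hw.comp_measurePreserving h).mono_measure (Measure.restrict_mono ?_ le_rfl)
    exact fun s hs => ⟨le_of_lt hs.1, hs.2.2⟩
  have h := hmul n u (by rwa [htd])
  rw [htd, S.controlIntegral_add_time hlam hd0 ht (huL.integrable hp)] at h
  have e0 : u =ᵐ[volume.restrict (Set.Icc 0 d)] 0 := by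
    filter_upwards [ae_restrict_mem measurableSet_Icc] with s hs
    exact Set.indicator_of_notMem (by simpa using hs.2) _
  have e1 : (fun s => u (s + d)) =ᵐ[volume.restrict (Set.Icc 0 t)] w := by
    rw [← Measure.restrict_congr_set (Ioc_ae_eq_Icc (α := ℝ) (μ := volume))]
    filter_upwards [ae_restrict_mem measurableSet_Ioc] with s hs
    rw [hu, Set.indicator_of_mem (by simpa using hs.1), add_sub_cancel_right]
  rwa [S.controlIntegral_congr hlam hd0 e0, S.controlIntegral_congr hlam ht e1,
    S.controlIntegral_zero, map_zero, zero_add] at h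

theorem exists_isControlValue {p : ENNReal} (hp : 1 ≤ p) (hB : S.IsAdmissible p)
    {μ : 𝕜} (hμ : μ ∈ resolventSetOf S.A) {t : ℝ} (ht : 0 ≤ t) {u : ℝ → U}
    (hu : MemLp u p (volume.restrict (Set.Icc 0 t))) : ∃ x, S.IsControlValue hμ t u x := by
  obtain ⟨lam, hlam, H⟩ := S.exists_gen_controlIntegral hp hB
  obtain ⟨y, hy⟩ := H t ht u hu
  refine ⟨lam • S.controlIntegral hlam t u - y,
    S.isControlValue_of hμ hlam ht (hu.integrable hp) ?_⟩
  rw [isControlValue_iff]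
  simpa using hy

end BoundaryControlSystem

/-! ### A Vitali-Hahn-Saks argument on order intervals of `L¹`. -/

theorem isClosed_setOf_ae_norm_le {α U : Type*} [MeasurableSpace α] {ν : Measure α}
    [NormedAddCommGroup U] (g : α → ℝ) :
    IsClosed {w : Lp U 1 ν | ∀ᵐ a ∂ν, ‖w a‖ ≤ g a} := by
  refine IsSeqClosed.isClosed fun w w₀ hw hlim => ?_
  obtain ⟨ns, -, hns⟩ := (tendstoInMeasure_of_tendsto_Lp hlim).exists_seq_tendsto_ae
  have hall : ∀ᵐ a ∂ν, ∀ n, ‖w n a‖ ≤ g a := ae_all_iff.2 hw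
  filter_upwards [hns, hall] with a ha hb
  exact le_of_tendsto ha.norm (Eventually.of_forall fun n => hb _)

/-- A Vitali-Hahn-Saks theorem: the pointwise limit, on an order interval of `L¹`, of a sequence of
bounded linear operators on `L¹` is continuous at `0` for the `L¹`-norm. -/
theorem exists_delta_norm_limit_le {α U X : Type*} [MeasurableSpace α] {ν : Measure α}
    [NormedAddCommGroup U] [NormedSpace ℝ U] [CompleteSpace U]
    [NormedAddCommGroup X] [NormedSpace ℝ X] (Ψ : ℕ → Lp U 1 ν →L[ℝ] X) {g : α → ℝ}
    (hg : AEStronglyMeasurable g ν)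
    (hΨ : ∀ w : Lp U 1 ν, (∀ᵐ a ∂ν, ‖w a‖ ≤ g a) → ∃ y, Tendsto (fun n => Ψ n w) atTop (𝓝 y))
    {ε : ℝ} (hε : 0 < ε) :
    ∃ δ > 0, ∀ w : Lp U 1 ν, (∀ᵐ a ∂ν, ‖w a‖ ≤ g a) → ‖w‖ < δ → ∀ y,
      Tendsto (fun n => Ψ n w) atTop (𝓝 y) → ‖y‖ ≤ ε := by
  set K : Set (Lp U 1 ν) := {w | ∀ᵐ a ∂ν, ‖w a‖ ≤ g a} with hK
  by_cases hne : K.Nonempty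
  swap
  · exact ⟨1, one_pos, fun w hw => (hne ⟨w, hw⟩).elim⟩
  have hKc : IsClosed K := isClosed_setOf_ae_norm_le g
  have : CompleteSpace K := hKc.completeSpace_coe
  have : Nonempty K := hne.to_subtype
  -- By Baire, one of these closed sets, which cover the complete space `K`, contains a ball of `K`
  -- around some `w₀`.
  let F : ℕ → Set K := fun N => {w | ∀ n ≥ N, ∀ m ≥ N, ‖Ψ n w - Ψ m w‖ ≤ ε / 4}
  have hFc : ∀ N, IsClosed (F N) := by
    intro N
    simp only [F, Set.ofPred_forall]
    refine isClosed_iInter fun n => isClosed_iInter fun _ => isClosed_iInter fun m =>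
      isClosed_iInter fun _ => ?_
    exact isClosed_le ((((Ψ n).continuous.sub (Ψ m).continuous).comp continuous_subtype_val).norm)
      continuous_const
  have hFu : ⋃ N, F N = Set.univ := by
    refine Set.eq_univ_of_forall fun w => Set.mem_iUnion.2 ?_
    obtain ⟨y, hy⟩ := hΨ w w.2
    obtain ⟨N, hN⟩ := Metric.cauchySeq_iff.1 hy.cauchySeq (ε / 4) (by positivity)
    exact ⟨N, fun n hn m hm => by rw [← dist_eq_norm]; exact (hN n hn m hm).le⟩
  obtain ⟨N, ⟨w₀, hw₀K⟩, hw₀⟩ := nonempty_interior_of_iUnion_of_closed hFc hFu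
  obtain ⟨r, hr, hball⟩ := Metric.isOpen_iff.1 isOpen_interior _ hw₀
  have hF : ∀ w ∈ K, ‖w - w₀‖ < r → ∀ n ≥ N, ‖Ψ n w - Ψ N w‖ ≤ ε / 4 := by
    intro w hw hwr n hn
    have : (⟨w, hw⟩ : K) ∈ F N := interior_subset (hball (by
      rw [Metric.mem_ball, Subtype.dist_eq, dist_eq_norm]
      exact hwr))
    exact this n hn N le_rfl
  -- The first bound keeps two perturbations of `w₀` within distance `r`; the second gives `‖Ψ N w‖
  -- ≤ ε / 4`.
  refine ⟨min (r / 2) (ε / (4 * (‖Ψ N‖ + 1))), by positivity, fun w hw hwδ y hy => ?_⟩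
  have hwr : ‖w‖ < r / 2 := hwδ.trans_le (min_le_left _ _)
  have hwN : ‖Ψ N w‖ ≤ ε / 4 := by
    have h1 := hwδ.trans_le (min_le_right _ _)
    rw [lt_div_iff₀ (by positivity)] at h1
    have h2 := (Ψ N).le_opNorm w
    nlinarith [norm_nonneg w]
  have hw₀L : Integrable w₀ ν := L1.integrable_coeFn w₀
  -- `w₀ + w` may leave the order interval, so `w₀` is first shrunk just enough to make room for
  -- `w`. Then `w` is the difference of `w₂ + w` and `w₂`, both in `K` and near `w₀`. Where `g = 0`
  -- the quotient is `0`, and `w` and `w₀` vanish there.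
  set f : α → U := fun a => (1 - ‖w a‖ / g a) • w₀ a with hf
  have hθ : ∀ᵐ a ∂ν, 0 ≤ ‖w a‖ / g a ∧ ‖w a‖ / g a ≤ 1 ∧ 0 ≤ g a := by
    filter_upwards [hw] with a ha
    have h0 : 0 ≤ g a := (norm_nonneg _).trans ha
    exact ⟨by positivity, div_le_one_of_le₀ ha h0, h0⟩
  have hfm : AEStronglyMeasurable f ν :=
    (aestronglyMeasurable_const.sub
      ((Lp.aestronglyMeasurable w).norm.div₀ hg)).smul (Lp.aestronglyMeasurable w₀)
  have hfn : ∀ᵐ a ∂ν, ‖f a‖ = (1 - ‖w a‖ / g a) * ‖w₀ a‖ := by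
    filter_upwards [hθ] with a ha
    rw [hf, norm_smul, Real.norm_eq_abs, abs_of_nonneg (by linarith [ha.2.1])]
  have hfL : Integrable f ν := by
    refine hw₀L.norm.mono' hfm ?_
    filter_upwards [hθ, hfn] with a ha hb
    rw [hb]
    exact mul_le_of_le_one_left (norm_nonneg _) (by linarith [ha.1])
  set w₂ : Lp U 1 ν := hfL.toL1 f with hw₂
  have hw₂K : w₂ ∈ K := by
    change ∀ᵐ a ∂ν, ‖w₂ a‖ ≤ g a
    filter_upwards [hθ, hfn, hfL.coeFn_toL1, hw₀K] with a ha hb hc hd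
    rw [hc, hb]
    exact (mul_le_of_le_one_left (norm_nonneg _) (by linarith [ha.1])).trans hd
  have hw₁K : w₂ + w ∈ K := by
    change ∀ᵐ a ∂ν, ‖(w₂ + w : Lp U 1 ν) a‖ ≤ g a
    filter_upwards [hθ, hfn, hfL.coeFn_toL1, hw₀K, Lp.coeFn_add w₂ w, hw] with a ha hb hc hd he hi
    rw [he, Pi.add_apply, hc]
    refine (norm_add_le _ _).trans ?_
    rw [hb]
    rcases ha.2.2.eq_or_lt with h0 | h0
    · rw [← h0] at hd hi ⊢
      simp [le_antisymm hd (norm_nonneg _), le_antisymm hi (norm_nonneg _)]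
    · have h1 : (1 - ‖w a‖ / g a) * ‖w₀ a‖ ≤ (1 - ‖w a‖ / g a) * g a :=
        mul_le_mul_of_nonneg_left hd (by linarith [ha.2.1])
      have h2 : (1 - ‖w a‖ / g a) * g a = g a - ‖w a‖ := by field_simp
      linarith
  have hdist : ‖w₂ - w₀‖ ≤ ‖w‖ := by
    refine Lp.norm_le_norm_of_ae_le ?_
    filter_upwards [hθ, hfL.coeFn_toL1, hw₀K, Lp.coeFn_sub w₂ w₀, hw] with a ha hc hd he hi
    rw [he, Pi.sub_apply, hc, hf]
    have e : (1 - ‖w a‖ / g a) • w₀ a - w₀ a = -((‖w a‖ / g a) • w₀ a) := by module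
    simp only [e]
    rw [norm_neg, norm_smul, Real.norm_eq_abs, abs_of_nonneg ha.1]
    rcases ha.2.2.eq_or_lt with h0 | h0
    · simp [← h0]
    · calc _ ≤ ‖w a‖ / g a * g a := mul_le_mul_of_nonneg_left hd ha.1
        _ = ‖w a‖ := by field_simp
  have hdist' : ‖w₂ + w - w₀‖ < r := by
    have := norm_add_le (w₂ - w₀) w
    rw [show w₂ + w - w₀ = w₂ - w₀ + w by abel]
    linarith
  have key : ∀ n ≥ N, ‖Ψ n w‖ ≤ ε := by
    intro n hn
    have h1 := hF _ hw₁K hdist' n hn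
    have h2 := hF _ hw₂K (by linarith) n hn
    have e : Ψ n w = (Ψ n (w₂ + w) - Ψ N (w₂ + w)) - (Ψ n w₂ - Ψ N w₂) + Ψ N w := by
      rw [map_add, map_add]; abel
    rw [e]
    refine (norm_add_le _ _).trans ?_
    have := norm_sub_le (Ψ n (w₂ + w) - Ψ N (w₂ + w)) (Ψ n w₂ - Ψ N w₂)
    linarith
  exact le_of_tendsto hy.norm ((eventually_ge_atTop N).mono key)

/-! ### Continuity of the controllability map under dominated `L¹` convergence. -/

namespace BoundaryControlSystem

variable {𝕜 X Y U : Type*} [RCLike 𝕜]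
    [NormedAddCommGroup X] [NormedSpace ℝ X] [NormedSpace 𝕜 X] [CompleteSpace X]
    [NormedAddCommGroup Y] [NormedSpace 𝕜 Y] [CompleteSpace Y]
    [NormedAddCommGroup U] [NormedSpace 𝕜 U]
    (S : BoundaryControlSystem 𝕜 X Y U)

theorem controlIntegral_add {lam : 𝕜} (hlam : lam ∈ resolventSetOf S.A) {t : ℝ} (ht : 0 ≤ t)
    {u w : ℝ → U} (hu : Integrable u (volume.restrict (Set.Icc 0 t)))
    (hw : Integrable w (volume.restrict (Set.Icc 0 t))) :
    S.controlIntegral hlam t (u + w) = S.controlIntegral hlam t u + S.controlIntegral hlam t w := by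
  rw [S.controlIntegral_eq hlam ht, S.controlIntegral_eq hlam ht, S.controlIntegral_eq hlam ht,
    ← integral_add (S.integrable_ext_Bop hlam hu) (S.integrable_ext_Bop hlam hw)]
  simp only [Pi.add_apply, map_add]

theorem isControlValue_add {lam : 𝕜} (hlam : lam ∈ resolventSetOf S.A) {t : ℝ} (ht : 0 ≤ t)
    {u w : ℝ → U} (hu : Integrable u (volume.restrict (Set.Icc 0 t)))
    (hw : Integrable w (volume.restrict (Set.Icc 0 t))) {x y : X}
    (hx : S.IsControlValue hlam t u x) (hy : S.IsControlValue hlam t w y) :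
    S.IsControlValue hlam t (u + w) (x + y) := by
  rw [isControlValue_iff] at *
  rw [S.controlIntegral_add hlam ht hu hw]
  convert hx.add hy using 1
  module

theorem isControlValue_ae_congr {lam : 𝕜} (hlam : lam ∈ resolventSetOf S.A) {t : ℝ} (ht : 0 ≤ t)
    {u w : ℝ → U} (h : u =ᵐ[volume.restrict (Set.Icc 0 t)] w) {x : X} :
    S.IsControlValue hlam t u x ↔ S.IsControlValue hlam t w x := by
  rw [isControlValue_iff, isControlValue_iff, S.controlIntegral_congr hlam ht h]

omit [CompleteSpace X] [CompleteSpace Y] in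
theorem isControlValue_unique {lam : 𝕜} (hlam : lam ∈ resolventSetOf S.A) {t : ℝ}
    {u : ℝ → U} {x y : X} (hx : S.IsControlValue hlam t u x) (hy : S.IsControlValue hlam t u y) :
    x = y := by
  obtain ⟨_, rfl⟩ := hx
  obtain ⟨_, rfl⟩ := hy
  rfl

/-- `w` is an `L^p` control whose controllability map value lies in `C`. -/
def IsControlInto {lam : 𝕜} (hlam : lam ∈ resolventSetOf S.A) (p : ENNReal) (t : ℝ) (C : Set X)
    (w : ℝ → U) : Prop :=
  MemLp w p (volume.restrict (Set.Icc 0 t)) ∧ ∃ x ∈ C, S.IsControlValue hlam t w x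

theorem IsControlInto.add {S : BoundaryControlSystem 𝕜 X Y U}
    {p : ENNReal} (hp : 1 ≤ p) {lam : 𝕜} {hlam : lam ∈ resolventSetOf S.A} {t : ℝ} (ht : 0 ≤ t)
    {C : Set X} (hC : ∀ x ∈ C, ∀ y ∈ C, x + y ∈ C) {u w : ℝ → U}
    (hu : S.IsControlInto hlam p t C u) (hw : S.IsControlInto hlam p t C w) :
    S.IsControlInto hlam p t C (u + w) := by
  obtain ⟨hu, x, hx, hx'⟩ := hu
  obtain ⟨hw, y, hy, hy'⟩ := hw
  exact ⟨hu.add hw, x + y, hC x hx y hy,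
    S.isControlValue_add hlam ht (hu.integrable hp) (hw.integrable hp) hx' hy'⟩

variable [IsScalarTower ℝ 𝕜 X] [NormedSpace ℝ U] [IsScalarTower ℝ 𝕜 U]

/-- The map `u ↦ ∫₀ᵗ T(t-s) B_lam u(s) ds` as a bounded operator on `L¹`. -/
noncomputable def controlIntegralL1 {lam : 𝕜} (hlam : lam ∈ resolventSetOf S.A) (t : ℝ) :
    Lp U 1 (volume.restrict (Set.Icc 0 t)) →L[ℝ] X :=
  LinearMap.mkContinuousOfExistsBound
    { toFun := fun w => ∫ s, S.T.ext (t - s) (S.BopL hlam (w s)) ∂(volume.restrict (Set.Icc 0 t))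
      map_add' := fun u w => by
        rw [← integral_add (S.integrable_ext_Bop hlam (L1.integrable_coeFn u))
          (S.integrable_ext_Bop hlam (L1.integrable_coeFn w))]
        refine integral_congr_ae ?_
        filter_upwards [Lp.coeFn_add u w] with s hs
        rw [hs, Pi.add_apply, map_add, map_add]
      map_smul' := fun c w => by
        rw [RingHom.id_apply, ← integral_smul]
        refine integral_congr_ae ?_
        filter_upwards [Lp.coeFn_smul c w] with s hs
        rw [hs, Pi.smul_apply, ContinuousLinearMap.map_smul_of_tower,
          ContinuousLinearMap.map_smul_of_tower] }
    (by
      obtain ⟨M, hM1, hM⟩ := S.T.exists_norm_ext_le t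
      refine ⟨M * ‖S.BopL hlam‖, fun w => ?_⟩
      rw [L1.norm_eq_integral_norm, ← integral_const_mul]
      refine norm_integral_le_of_norm_le ((L1.integrable_coeFn w).norm.const_mul _) ?_
      filter_upwards [ae_restrict_mem measurableSet_Icc] with s hs
      rw [mul_assoc]
      exact ((S.T.ext (t - s)).le_of_opNorm_le (hM _ (by linarith [hs.1])) _).trans
        (by gcongr; exact (S.BopL hlam).le_opNorm _))

theorem controlIntegralL1_toL1 {lam : 𝕜} (hlam : lam ∈ resolventSetOf S.A) {t : ℝ} (ht : 0 ≤ t)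
    {u : ℝ → U} (hu : Integrable u (volume.restrict (Set.Icc 0 t))) :
    S.controlIntegralL1 hlam t (hu.toL1 u) = S.controlIntegral hlam t u := by
  rw [S.controlIntegral_eq hlam ht]
  refine integral_congr_ae ?_
  filter_upwards [hu.coeFn_toL1] with s hs
  rw [hs]

/-- Bounded operators on `L¹` which approximate the controllability map. -/
noncomputable def controlApprox {lam : 𝕜} (hlam : lam ∈ resolventSetOf S.A) (t : ℝ) (n : ℕ) :
    Lp U 1 (volume.restrict (Set.Icc 0 t)) →L[ℝ] X :=
  ((lam • ContinuousLinearMap.id 𝕜 X -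
    (1 / ((n : ℝ) + 1))⁻¹ • (S.T.op (1 / ((n : ℝ) + 1)) - ContinuousLinearMap.id 𝕜 X)).restrictScalars
      ℝ).comp (S.controlIntegralL1 hlam t)

/-- The operator `A` is replaced by its difference quotients at `h = 1 / (n + 1)`, which converge on
the domain of `A` by definition of the generator. -/
theorem tendsto_controlApprox {lam : 𝕜} (hlam : lam ∈ resolventSetOf S.A) {t : ℝ} (ht : 0 ≤ t)
    {u : ℝ → U} (hu : Integrable u (volume.restrict (Set.Icc 0 t))) {x : X}
    (hx : S.IsControlValue hlam t u x) :
    Tendsto (fun n => S.controlApprox hlam t n (hu.toL1 u)) atTop (𝓝 x) := by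
  rw [isControlValue_iff] at hx
  have h1 : Tendsto (fun n : ℕ => 1 / ((n : ℝ) + 1)) atTop (𝓝[>] 0) :=
    tendsto_nhdsWithin_iff.2 ⟨tendsto_one_div_add_atTop_nhds_zero_nat,
      Eventually.of_forall fun n => by
        rw [Set.mem_Ioi]
        positivity⟩
  have h2 := (hx.comp h1).const_sub (lam • S.controlIntegral hlam t u)
  rw [sub_sub_cancel] at h2
  refine h2.congr fun n => ?_
  simp only [controlApprox, Function.comp_apply, ContinuousLinearMap.comp_apply,
    ContinuousLinearMap.coe_restrictScalars', S.controlIntegralL1_toL1 hlam ht hu]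
  rfl

variable [CompleteSpace U]

theorem exists_delta_controlValue {p : ENNReal} (hp : 1 ≤ p) (hB : S.IsAdmissible p)
    {lam : 𝕜} (hlam : lam ∈ resolventSetOf S.A) {t : ℝ} (ht : 0 ≤ t) {g : ℝ → ℝ}
    (hg : MemLp g p (volume.restrict (Set.Icc 0 t))) {ε : ℝ} (hε : 0 < ε) :
    ∃ δ > 0, ∀ w : ℝ → U, AEStronglyMeasurable w (volume.restrict (Set.Icc 0 t)) →
      (∀ᵐ s ∂(volume.restrict (Set.Icc 0 t)), ‖w s‖ ≤ g s) →
      ∫ s, ‖w s‖ ∂(volume.restrict (Set.Icc 0 t)) < δ → ∀ x, S.IsControlValue hlam t w x →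
        ‖x‖ ≤ ε := by
  obtain ⟨δ, hδ, H⟩ := exists_delta_norm_limit_le (S.controlApprox hlam t)
    hg.aestronglyMeasurable (fun w hw => by
      have hwL : MemLp w p (volume.restrict (Set.Icc 0 t)) :=
        hg.mono' (Lp.aestronglyMeasurable w) hw
      obtain ⟨x, hx⟩ := S.exists_isControlValue hp hB hlam ht hwL
      have := S.tendsto_controlApprox hlam ht (hwL.integrable hp) hx
      rw [Integrable.toL1_coeFn] at this
      exact ⟨x, this⟩) hε
  refine ⟨δ, hδ, fun w hwm hw hwδ x hx => ?_⟩
  have hwi : Integrable w (volume.restrict (Set.Icc 0 t)) := (hg.integrable hp).mono' hwm hw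
  refine H (hwi.toL1 w) ?_ ?_ x (S.tendsto_controlApprox hlam ht hwi hx)
  · filter_upwards [hw, hwi.coeFn_toL1] with s hs hs'
    rwa [hs']
  · rwa [L1.norm_of_fun_eq_integral_norm]

/-- A single dominating `g` in `L^p` for all errors, together with smallness in `L¹`, makes the
control values converge; no approximation in `L^p` norm is asked for. -/
theorem IsControlInto.of_approx {S : BoundaryControlSystem 𝕜 X Y U}
    {p : ENNReal} (hp : 1 ≤ p) (hB : S.IsAdmissible p)
    {lam : 𝕜} {hlam : lam ∈ resolventSetOf S.A} {t : ℝ} (ht : 0 ≤ t) {C : Set X}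
    (hC : IsClosed C) {g : ℝ → ℝ} (hg : MemLp g p (volume.restrict (Set.Icc 0 t)))
    {w : ℝ → U} (hw : MemLp w p (volume.restrict (Set.Icc 0 t)))
    (H : ∀ δ > 0, ∃ w', S.IsControlInto hlam p t C w' ∧
      (∀ᵐ s ∂(volume.restrict (Set.Icc 0 t)), ‖w s - w' s‖ ≤ g s) ∧
      ∫ s, ‖w s - w' s‖ ∂(volume.restrict (Set.Icc 0 t)) < δ) : S.IsControlInto hlam p t C w := by
  obtain ⟨x, hx⟩ := S.exists_isControlValue hp hB hlam ht hw
  refine ⟨hw, x, ?_, hx⟩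
  rw [← hC.closure_eq, Metric.mem_closure_iff]
  intro ε hε
  obtain ⟨δ, hδ, H'⟩ := S.exists_delta_controlValue hp hB hlam ht hg (half_pos hε)
  obtain ⟨w', ⟨hw', x', hx'C, hx'⟩, h1, h2⟩ := H δ hδ
  obtain ⟨y, hy⟩ := S.exists_isControlValue hp hB hlam ht (hw.sub hw')
  have hyn := H' (w - w') (hw.sub hw').aestronglyMeasurable h1 h2 y hy
  have hadd := S.isControlValue_add hlam ht ((hw.sub hw').integrable hp) (hw'.integrable hp) hy hx'
  rw [sub_add_cancel] at hadd
  refine ⟨x', hx'C, ?_⟩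
  rw [S.isControlValue_unique hlam hx hadd, dist_eq_norm, add_sub_cancel_right]
  linarith

end BoundaryControlSystem

/-! ### From exponential controls on intervals to all positive controls. -/

namespace BoundaryControlSystem

variable {𝕜 X Y U : Type*} [RCLike 𝕜]
    [NormedAddCommGroup X] [NormedSpace ℝ X] [NormedSpace 𝕜 X] [CompleteSpace X]
    [NormedAddCommGroup Y] [NormedSpace 𝕜 Y] [CompleteSpace Y]
    [NormedAddCommGroup U] [NormedSpace 𝕜 U]
    [IsScalarTower ℝ 𝕜 X] [NormedSpace ℝ U] [IsScalarTower ℝ 𝕜 U]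

theorem isControlValue_indicator_Ioc (S : BoundaryControlSystem 𝕜 X Y U) {lam : ℝ}
    (hlam : (lam : 𝕜) ∈ resolventSetOf S.A) {α β t : ℝ} (hα : 0 ≤ α) (hαβ : α ≤ β) (hβ : β ≤ t)
    (v : U) :
    S.IsControlValue hlam t ((Set.Ioc α β).indicator fun s => Real.exp (lam * s) • v)
      (Real.exp (lam * β) • S.T.op (t - β) (S.Bop hlam v)
            - Real.exp (lam * α) • S.T.op (t - α) (S.Bop hlam v)) := by
  have ht : 0 ≤ t := hα.trans (hαβ.trans hβ)
  have e : S.controlIntegral hlam t ((Set.Ioc α β).indicator fun s => Real.exp (lam * s) • v) =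
      ∫ s in α..β, Real.exp (lam * s) • S.T.ext (t - s) (S.BopL hlam v) := by
    have e1 : ∀ s, S.T.ext (t - s) (S.BopL hlam
        ((Set.Ioc α β).indicator (fun s => Real.exp (lam * s) • v) s)) =
        (Set.Ioc α β).indicator
          (fun s => Real.exp (lam * s) • S.T.ext (t - s) (S.BopL hlam v)) s := by
      intro s
      by_cases hs : s ∈ Set.Ioc α β
      · rw [Set.indicator_of_mem hs, Set.indicator_of_mem hs,
          ContinuousLinearMap.map_smul_of_tower, ContinuousLinearMap.map_smul_of_tower]
      · rw [Set.indicator_of_notMem hs, Set.indicator_of_notMem hs, map_zero, map_zero]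
    rw [S.controlIntegral_eq hlam ht]
    simp only [e1]
    rw [setIntegral_indicator measurableSet_Ioc, intervalIntegral.integral_of_le hαβ,
      Set.inter_eq_self_of_subset_right]
    exact fun s hs => ⟨hα.trans hs.1.le, hs.2.trans hβ⟩
  have h := S.T.gen_integral (S.BopL hlam v) lam hαβ hβ
  rw [isControlValue_iff, e, ← RCLike.real_smul_eq_coe_smul]
  rw [S.T.ext_of_nonneg (sub_nonneg.2 hβ), S.T.ext_of_nonneg (sub_nonneg.2 (hαβ.trans hβ))] at h
  exact h

theorem memLp_indicator_exp_smul (lam t : ℝ) (p : ENNReal) {E : Set ℝ} (hE : MeasurableSet E)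
    (v : U) : MemLp (E.indicator fun s => Real.exp (lam * s) • v) p
      (volume.restrict (Set.Icc 0 t)) := by
  refine MemLp.indicator hE ?_
  have hc : Continuous fun s : ℝ => Real.exp (lam * s) • v := by fun_prop
  obtain ⟨C, hC⟩ := isCompact_Icc.exists_bound_of_continuousOn
    (hc.continuousOn (s := Set.Icc (0 : ℝ) t))
  exact MemLp.of_bound hc.aestronglyMeasurable C
    ((ae_restrict_mem measurableSet_Icc).mono fun s hs => hC s hs)

variable [CompleteSpace U] {S : BoundaryControlSystem 𝕜 X Y U} {p : ENNReal} {lam : ℝ}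
    {hlam : (lam : 𝕜) ∈ resolventSetOf S.A} {t : ℝ} {C : Set X} {K : Set U}

omit [CompleteSpace U] in
theorem isControlInto_indicator_Ioc (ht : 0 ≤ t)
    (H : ∀ α β : ℝ, 0 ≤ α → α ≤ β → β ≤ t → ∀ v ∈ K,
      Real.exp (lam * β) • S.T.op (t - β) (S.Bop hlam v)
        - Real.exp (lam * α) • S.T.op (t - α) (S.Bop hlam v) ∈ C)
    {v : U} (hv : v ∈ K) {α β : ℝ} (hαβ : α ≤ β) :
    S.IsControlInto hlam p t C ((Set.Ioc α β).indicator fun s => Real.exp (lam * s) • v) := by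
  have h0 : ∀ a, 0 ≤ max 0 (min a t) := fun a => le_max_left _ _
  have h1 : ∀ a, max 0 (min a t) ≤ t := fun a => max_le ht (min_le_right _ _)
  have h2 : max 0 (min α t) ≤ max 0 (min β t) := by gcongr
  refine ⟨memLp_indicator_exp_smul lam t p measurableSet_Ioc v, _,
    H _ _ (h0 α) h2 (h1 β) v hv, ?_⟩
  refine (S.isControlValue_ae_congr hlam ht ?_).1
    (S.isControlValue_indicator_Ioc hlam (h0 α) h2 (h1 β) v)
  -- The point `0` is discarded: for `α < 0 ≤ β` it lies in `(α, β]` but not in the interval clamped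
  -- to `[0, t]`.
  rw [← Measure.restrict_congr_set (Ioc_ae_eq_Icc (α := ℝ) (μ := volume))]
  filter_upwards [ae_restrict_mem measurableSet_Ioc] with s hs
  have : s ∈ Set.Ioc (max 0 (min α t)) (max 0 (min β t)) ↔ s ∈ Set.Ioc α β := by
    have hs1 := hs.1
    have hs2 := hs.2
    simp only [Set.mem_Ioc, max_lt_iff, min_lt_iff, le_max_iff, le_min_iff]
    constructor
    · rintro ⟨⟨_, h | h⟩, h' | h'⟩
      · linarith
      · exact ⟨h, h'.1⟩
      · linarith
      · linarith
    · rintro ⟨h, h'⟩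
      exact ⟨⟨hs1, Or.inl h⟩, Or.inr ⟨h', hs2⟩⟩
  simp only [Set.indicator, this]

omit [CompleteSpace X] [CompleteSpace Y] [IsScalarTower ℝ 𝕜 X] [NormedSpace ℝ U]
  [IsScalarTower ℝ 𝕜 U] [CompleteSpace U] in
theorem isControlInto_zero (hC0 : (0 : X) ∈ C) :
    S.IsControlInto hlam p t C 0 := by
  refine ⟨MemLp.zero, 0, hC0, ?_⟩
  rw [isControlValue_iff, S.controlIntegral_zero, smul_zero, sub_zero]
  refine Tendsto.congr (f₁ := fun _ => 0) (fun h => ?_) tendsto_const_nhds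
  simp

theorem isControlInto_indicator (hp : 1 ≤ p) (hB : S.IsAdmissible p) (ht : 0 ≤ t)
    (hC : IsClosed C) (hC0 : (0 : X) ∈ C) (hCadd : ∀ x ∈ C, ∀ y ∈ C, x + y ∈ C)
    (H : ∀ α β : ℝ, 0 ≤ α → α ≤ β → β ≤ t → ∀ v ∈ K,
      Real.exp (lam * β) • S.T.op (t - β) (S.Bop hlam v)
        - Real.exp (lam * α) • S.T.op (t - α) (S.Bop hlam v) ∈ C)
    {v : U} (hv : v ∈ K) {E : Set ℝ} (hE : MeasurableSet E) :
    S.IsControlInto hlam p t C (E.indicator fun s => Real.exp (lam * s) • v) := by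
  set ν := volume.restrict (Set.Icc 0 t) with hν
  set f : ℝ → U := fun s => Real.exp (lam * s) • v with hf
  have hfc : Continuous f := by fun_prop
  obtain ⟨c, hc⟩ := isCompact_Icc.exists_bound_of_continuousOn
    (hfc.continuousOn (s := Set.Icc (0 : ℝ) t))
  have hc0 : 0 ≤ c := (norm_nonneg _).trans (hc 0 ⟨le_rfl, ht⟩)
  refine IsControlInto.of_approx hp hB ht hC (memLp_const c)
    (memLp_indicator_exp_smul lam t p hE v) fun δ hδ => ?_
  have hgen : (inferInstance : MeasurableSpace ℝ) =
      MeasurableSpace.generateFrom {s : Set ℝ | ∃ u v, u ≤ v ∧ s = Set.Ioc u v} := by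
    rw [BorelSpace.measurable_eq (α := ℝ), borel_eq_generateFrom_Ioc_le]
    exact congrArg MeasurableSpace.generateFrom (Set.ext fun s => ⟨fun ⟨u, v, h, e⟩ => ⟨u, v, h, e.symm⟩,
      fun ⟨u, v, h, e⟩ => ⟨u, v, h, e.symm⟩⟩)
  -- `E` is approximated in measure by a finite disjoint union of half-open intervals. The covering
  -- interval starts at `-1` so that it contains the left endpoint `0`, and `c + 1` keeps the
  -- tolerance meaningful when `c = 0`.
  obtain ⟨G, hG, hGE⟩ := exists_measure_symmDiff_lt_of_generateFrom_isSetSemiring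
    (μ := ν) IsSetSemiring.Ioc ⟨{Set.Ioc (-1) t}, Set.countable_singleton _,
      by simpa using ⟨-1, t, by linarith, rfl⟩, by
        rw [Set.sUnion_singleton, hν, Measure.restrict_apply measurableSet_Ioc.compl]
        convert measure_empty (μ := (volume : Measure ℝ))
        ext s
        simp only [Set.mem_inter_iff, Set.mem_compl_iff, Set.mem_Ioc, Set.mem_Icc,
          Set.mem_empty_iff_false, iff_false]
        rintro ⟨h, h0, h1⟩
        exact h ⟨by linarith, h1⟩⟩ hgen hE
    (ε := ENNReal.ofReal (δ / (c + 1))) (ENNReal.ofReal_pos.2 (by positivity))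
  obtain ⟨P, hP⟩ := IsSetSemiring.Ioc.mem_supClosure_iff.1 hG
  have hU : G = ⋃ J ∈ P.parts, J :=
    P.sup_parts.symm.trans (by rw [Finset.sup_id_set_eq_sUnion, Set.sUnion_eq_biUnion]; rfl)
  have hGm : MeasurableSet G := by
    have : MeasurableSet (⋃ J ∈ P.parts, J) := Finset.measurableSet_biUnion _ fun J hJ => by
      obtain ⟨a, b, -, rfl⟩ := hP hJ
      exact measurableSet_Ioc
    rwa [← hU] at this
  have hind : ∀ s, ‖E.indicator f s - G.indicator f s‖ = (symmDiff G E).indicator (fun s => ‖f s‖) s := by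
    intro s
    by_cases h1 : s ∈ E <;> by_cases h2 : s ∈ G <;>
      simp [Set.indicator, Set.mem_symmDiff, h1, h2]
  refine ⟨G.indicator f, ?_, ?_, ?_⟩
  · have hsum : G.indicator f = ∑ J ∈ P.parts, J.indicator f := by
      have h1 := Finset.indicator_biUnion P.parts (fun J => J) P.disjoint (f := f)
      rw [← hU] at h1
      rw [h1]
      ext s
      rw [Finset.sum_apply]
    rw [hsum]
    refine Finset.sum_induction _ (fun w => S.IsControlInto hlam p t C w)
      (fun u w hu hw => hu.add hp ht hCadd hw) (isControlInto_zero hC0) fun J hJ => ?_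
    obtain ⟨a, b, hab, rfl⟩ := hP hJ
    exact isControlInto_indicator_Ioc ht H hv hab
  · filter_upwards [ae_restrict_mem measurableSet_Icc] with s hs
    rw [hind]
    exact Set.indicator_le' (fun _ _ => hc s hs) (fun _ _ => hc0) s
  · simp only [hind]
    rw [integral_indicator (hGm.symmDiff hE)]
    have h1 : ν.real (symmDiff G E) < δ / (c + 1) := by
      rw [Measure.real]
      exact (ENNReal.lt_ofReal_iff_toReal_lt (measure_ne_top _ _)).1 hGE
    calc ∫ s in symmDiff G E, ‖f s‖ ∂ν ≤ ∫ s in symmDiff G E, c ∂ν := by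
          refine integral_mono_of_nonneg (Eventually.of_forall fun _ => norm_nonneg _)
            (integrable_const _) (ae_restrict_of_ae ?_)
          filter_upwards [ae_restrict_mem measurableSet_Icc] with s hs using hc s hs
      _ = ν.real (symmDiff G E) * c := by
          rw [setIntegral_const, smul_eq_mul]
      _ ≤ ν.real (symmDiff G E) * (c + 1) := by gcongr; linarith
      _ < δ := by rwa [← lt_div_iff₀ (by positivity)]

theorem isControlInto_simpleFunc (hp : 1 ≤ p) (hB : S.IsAdmissible p) (ht : 0 ≤ t)
    (hC : IsClosed C) (hC0 : (0 : X) ∈ C) (hCadd : ∀ x ∈ C, ∀ y ∈ C, x + y ∈ C)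
    (hK0 : (0 : U) ∈ K)
    (H : ∀ α β : ℝ, 0 ≤ α → α ≤ β → β ≤ t → ∀ v ∈ K,
      Real.exp (lam * β) • S.T.op (t - β) (S.Bop hlam v)
        - Real.exp (lam * α) • S.T.op (t - α) (S.Bop hlam v) ∈ C)
    (φ : SimpleFunc ℝ U) (hφ : ∀ s, φ s ∈ K) :
    S.IsControlInto hlam p t C (fun s => Real.exp (lam * s) • φ s) := by
  induction φ using SimpleFunc.induction with
  | const c hs =>
    rename_i E
    -- The value `c` is known to lie in `K` only if it is attained.
    rcases E.eq_empty_or_nonempty with rfl | ⟨s, hsE⟩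
    · convert isControlInto_zero (S := S) (p := p) (hlam := hlam) hC0 using 1
      ext s
      simp
    · have hc : c ∈ K := by simpa [hsE] using hφ s
      convert isControlInto_indicator hp hB ht hC hC0 hCadd H hc hs using 1
      ext s
      by_cases h : s ∈ E <;> simp [h]
  | add hd hf hg =>
    rename_i f g
    have hz : ∀ s, f s = 0 ∨ g s = 0 := by
      intro s
      by_contra! h
      exact Set.disjoint_left.1 hd (Function.mem_support.2 h.1) (Function.mem_support.2 h.2)
    have h1 := hf fun s => by
      rcases hz s with h | h
      · rwa [h]
      · simpa [h] using hφ s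
    have h2 := hg fun s => by
      rcases hz s with h | h
      · simpa [h] using hφ s
      · rwa [h]
    convert h1.add hp ht hCadd h2 using 1
    ext s
    simp

/-- Positivity of the exponential increments of `T(t-·) B_lam` implies positivity of the exact
reachability space, for all exponents `p ≥ 1`, including `p = ∞`. -/
theorem exactPos_subset_of_increments (hp : 1 ≤ p) (hB : S.IsAdmissible p) (ht : 0 ≤ t)
    (hC : IsClosed C) (hC0 : (0 : X) ∈ C) (hCadd : ∀ x ∈ C, ∀ y ∈ C, x + y ∈ C)
    (hK : IsClosed K) (hK0 : (0 : U) ∈ K) (hKsmul : ∀ c : ℝ, 0 ≤ c → ∀ v ∈ K, c • v ∈ K)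
    (H : ∀ α β : ℝ, 0 ≤ α → α ≤ β → β ≤ t → ∀ v ∈ K,
      Real.exp (lam * β) • S.T.op (t - β) (S.Bop hlam v)
        - Real.exp (lam * α) • S.T.op (t - α) (S.Bop hlam v) ∈ C) :
    S.exactPos hlam p K t ⊆ C := by
  rintro x ⟨u, hu, huK, hx⟩
  set ν := volume.restrict (Set.Icc 0 t) with hν
  borelize U
  set u₁ := hu.aestronglyMeasurable.mk u with hu₁
  have hu₁m : StronglyMeasurable u₁ := hu.aestronglyMeasurable.stronglyMeasurable_mk
  -- A representative of `u` that is strongly measurable and takes values in `K` everywhere.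
  set u₂ := (u₁ ⁻¹' K).indicator u₁ with hu₂
  have hu₂m : StronglyMeasurable u₂ := hu₁m.indicator (hu₁m.measurable hK.measurableSet)
  have hu₂K : ∀ s, u₂ s ∈ K := by
    intro s
    by_cases hs : s ∈ u₁ ⁻¹' K
    · rw [hu₂, Set.indicator_of_mem hs]; exact hs
    · rw [hu₂, Set.indicator_of_notMem hs]; exact hK0
  have hae : u =ᵐ[ν] u₂ := by
    filter_upwards [hu.aestronglyMeasurable.ae_eq_mk, huK] with s hs hsK
    have : s ∈ u₁ ⁻¹' K := by rw [Set.mem_preimage, hu₁, ← hs]; exact hsK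
    rw [hu₂, Set.indicator_of_mem this, hs]
  have hu₂L : MemLp u₂ p ν := (memLp_congr_ae hae).1 hu
  suffices h : S.IsControlInto hlam p t C u₂ by
    obtain ⟨-, y, hy, hy'⟩ := h
    rwa [S.isControlValue_unique hlam hx ((S.isControlValue_ae_congr hlam ht hae).2 hy')]
  -- The basic controls carry the factor `exp (lam s)`, so it is removed before approximating by
  -- simple functions. Their values are taken from the range of `f` and `0`, hence stay in `K`.
  set f : ℝ → U := fun s => Real.exp (-(lam * s)) • u₂ s with hf
  have hfm : StronglyMeasurable f :=
    (by fun_prop : Continuous fun s : ℝ => Real.exp (-(lam * s))).stronglyMeasurable.smul hu₂m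
  have hfK : ∀ s, f s ∈ K := fun s => hKsmul _ (Real.exp_pos _).le _ (hu₂K s)
  have hfu : ∀ s, u₂ s = Real.exp (lam * s) • f s := by
    intro s
    rw [hf, smul_smul, ← Real.exp_add, add_neg_cancel, Real.exp_zero, one_smul]
  have := hfm.separableSpace_range_union_singleton (b := 0)
  set φ := SimpleFunc.approxOn f hfm.measurable (Set.range f ∪ {0}) 0 (by simp) with hφ
  have hφK : ∀ n s, φ n s ∈ K := by
    intro n s
    rcases SimpleFunc.approxOn_mem hfm.measurable
      (show (0 : U) ∈ Set.range f ∪ {0} by simp) n s with ⟨r, hr⟩ | h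
    · rw [hφ, ← hr]; exact hfK r
    · rw [hφ, Set.mem_singleton_iff.1 h]; exact hK0
  -- Approximating from base point `0` bounds every error by `‖u₂‖`, the `L^p` function that defines
  -- the order interval.
  have hdiff : ∀ n s, ‖u₂ s - Real.exp (lam * s) • φ n s‖ ≤ ‖u₂ s‖ := by
    intro n s
    have h1 := SimpleFunc.nnnorm_approxOn_le hfm.measurable
      (show (0 : U) ∈ Set.range f ∪ {0} by simp) s n
    rw [sub_zero] at h1
    have h2 : ‖φ n s - f s‖ ≤ ‖f s‖ := h1
    rw [hfu, ← smul_sub, norm_smul, norm_smul, norm_sub_rev]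
    gcongr
  have hlim : Tendsto (fun n => ∫ s, ‖u₂ s - Real.exp (lam * s) • φ n s‖ ∂ν) atTop (𝓝 0) := by
    rw [← integral_zero ℝ ℝ (μ := ν)]
    refine tendsto_integral_of_dominated_convergence (fun s => ‖u₂ s‖) (fun n => ?_)
      (hu₂L.integrable hp).norm (fun n => Eventually.of_forall fun s => ?_)
      (Eventually.of_forall fun s => ?_)
    · exact (hu₂m.sub ((by fun_prop : Continuous fun s : ℝ =>
        Real.exp (lam * s)).stronglyMeasurable.smul
          (φ n).stronglyMeasurable)).norm.aestronglyMeasurable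
    · rw [norm_norm]
      exact hdiff n s
    · have h1 : Tendsto (fun n => φ n s) atTop (𝓝 (f s)) :=
        SimpleFunc.tendsto_approxOn hfm.measurable _ (subset_closure (by simp))
      have h2 := ((h1.const_smul (Real.exp (lam * s))).const_sub (u₂ s)).norm
      rwa [← hfu, sub_self, norm_zero] at h2
  refine IsControlInto.of_approx hp hB ht hC hu₂L.norm hu₂L fun δ hδ => ?_
  obtain ⟨n, hn⟩ := (hlim.eventually (Iio_mem_nhds hδ)).exists
  exact ⟨_, isControlInto_simpleFunc hp hB ht hC hC0 hCadd hK0 H (φ n) (hφK n),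
    Eventually.of_forall (hdiff n), hn⟩

end BoundaryControlSystem

/-! ### Resolvent characterisations for positive semigroups. -/

namespace BoundaryControlSystem

variable {𝕜 X Y U : Type*} [RCLike 𝕜]
    [NormedAddCommGroup X] [NormedSpace ℝ X] [NormedSpace 𝕜 X] [CompleteSpace X]
    [NormedAddCommGroup Y] [NormedSpace 𝕜 Y] [CompleteSpace Y]
    [NormedAddCommGroup U] [NormedSpace 𝕜 U]
    [IsScalarTower ℝ 𝕜 X]

omit [CompleteSpace Y] in
/-- Points to the right of a growth exponent lie in the resolvent set, with the Laplace transform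
of the semigroup as resolvent. -/
theorem exists_resolvent (S : BoundaryControlSystem 𝕜 X Y U) {ω M lam : ℝ}
    (hM : ∀ t : ℝ, 0 ≤ t → ‖S.T.op t‖ ≤ M * Real.exp (ω * t)) (hlam : ω < lam) :
    ∃ R : X →L[𝕜] X, (∀ x, R x = ∫ s in Set.Ioi (0 : ℝ), Real.exp (-(lam * s)) • S.T.ext s x) ∧
      (∀ x, S.T.Gen (R x) ((lam : 𝕜) • R x - x)) ∧
      (∀ x y, S.T.Gen x y → R ((lam : 𝕜) • x - y) = x) ∧ ‖R‖ ≤ M / (lam - ω) := by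
  obtain ⟨R, h1, h2, h3, h4⟩ := S.T.exists_laplace hM hlam
  refine ⟨R, h1, fun x => ?_, fun x y hxy => ?_, h4⟩
  · rw [← RCLike.real_smul_eq_coe_smul]
    exact h2 x
  · rw [← RCLike.real_smul_eq_coe_smul, map_sub, ContinuousLinearMap.map_smul_of_tower,
      h3 x y hxy, sub_sub_cancel]

omit [CompleteSpace Y] in
theorem mem_resolventSetOf_of_growthBound_lt (S : BoundaryControlSystem 𝕜 X Y U) {lam : ℝ}
    (h : S.T.growthBound < (lam : EReal)) : (lam : 𝕜) ∈ resolventSetOf S.A := by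
  obtain ⟨ω, M, hω, hM⟩ := S.T.exists_bound_of_growthBound_lt h
  obtain ⟨R, -, h1, h2, -⟩ := S.exists_resolvent hM hω
  exact S.mem_resolventSetOf_iff.2 ⟨R, h1, h2⟩

theorem exactPos_eq (S : BoundaryControlSystem 𝕜 X Y U) {lam μ : 𝕜}
    (hlam : lam ∈ resolventSetOf S.A) (hμ : μ ∈ resolventSetOf S.A) {p : ENNReal} (hp : 1 ≤ p)
    (K : Set U) {t : ℝ} (ht : 0 ≤ t) : S.exactPos hμ p K t = S.exactPos hlam p K t := by
  ext x
  refine exists_congr fun u => and_congr_right fun hu => and_congr_right fun _ => ?_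
  exact S.isControlValue_congr hlam hμ ht (hu.integrable hp)

theorem increments_mem_of_exactPos_subset [NormedSpace ℝ U] [IsScalarTower ℝ 𝕜 U]
    {S : BoundaryControlSystem 𝕜 X Y U} {lam : ℝ}
    (hlam : (lam : 𝕜) ∈ resolventSetOf S.A) {p : ENNReal} {K : Set U}
    {C : Set X} {t : ℝ} (hK0 : (0 : U) ∈ K) (hKsmul : ∀ c : ℝ, 0 ≤ c → ∀ v ∈ K, c • v ∈ K)
    (h : S.exactPos hlam p K t ⊆ C) {α β : ℝ} (hα : 0 ≤ α) (hαβ : α ≤ β) (hβ : β ≤ t)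
    {v : U} (hv : v ∈ K) :
    Real.exp (lam * β) • S.T.op (t - β) (S.Bop hlam v)
      - Real.exp (lam * α) • S.T.op (t - α) (S.Bop hlam v) ∈ C := by
  refine h ⟨_, memLp_indicator_exp_smul lam t p measurableSet_Ioc v,
    Eventually.of_forall fun s => ?_, S.isControlValue_indicator_Ioc hlam hα hαβ hβ v⟩
  by_cases hs : s ∈ Set.Ioc α β
  · rw [Set.indicator_of_mem hs]
    exact hKsmul _ (Real.exp_pos _).le _ hv
  · rw [Set.indicator_of_notMem hs]
    exact hK0

variable {S : BoundaryControlSystem 𝕜 X Y U} {C : Set X}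

omit [CompleteSpace X] [CompleteSpace Y] [IsScalarTower ℝ 𝕜 X] in
-- Doubling: `exp (lam s) - T(s)` factors as `(exp (lam s/2) + T(s/2)) (exp (lam s/2) - T(s/2))`,
-- and the first factor preserves the cone.
theorem exp_smul_sub_op_mem (hCadd : ∀ x ∈ C, ∀ y ∈ C, x + y ∈ C)
    (hCsmul : ∀ c : ℝ, 0 ≤ c → ∀ x ∈ C, c • x ∈ C)
    (hT : ∀ s : ℝ, 0 ≤ s → ∀ x ∈ C, S.T.op s x ∈ C) {lam τ : ℝ} (hτ : 0 < τ) {x : X}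
    (h : ∀ s, 0 ≤ s → s ≤ τ → Real.exp (lam * s) • x - S.T.op s x ∈ C) {s : ℝ} (hs : 0 ≤ s) :
    Real.exp (lam * s) • x - S.T.op s x ∈ C := by
  have key : ∀ n : ℕ, ∀ s, 0 ≤ s → s ≤ 2 ^ n * τ →
      Real.exp (lam * s) • x - S.T.op s x ∈ C := by
    intro n
    induction n with
    | zero => simpa using h
    | succ n ih =>
      intro s hs hsn
      have hs2 : 0 ≤ s / 2 := by positivity
      have h1 := ih (s / 2) hs2 (by rw [pow_succ] at hsn; linarith)
      have h2 := hCadd _ (hCsmul _ (Real.exp_pos (lam * (s / 2))).le _ h1) _ (hT _ hs2 _ h1)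
      rw [smul_sub, smul_smul, ← Real.exp_add, map_sub, ContinuousLinearMap.map_smul_of_tower,
        S.T.op_op hs2 hs2, add_halves, ← mul_add, add_halves] at h2
      simpa using h2
  obtain ⟨n, hn⟩ := pow_unbounded_of_one_lt (s / τ) (one_lt_two : (1 : ℝ) < 2)
  exact key n s hs ((div_lt_iff₀ hτ).1 hn).le

omit [CompleteSpace Y] in
theorem Bop_mem_of_exp_smul_sub_op_mem (hC : IsClosed C) (hC0 : (0 : X) ∈ C)
    (hCadd : ∀ x ∈ C, ∀ y ∈ C, x + y ∈ C) (hCsmul : ∀ c : ℝ, 0 ≤ c → ∀ x ∈ C, c • x ∈ C)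
    {lam ν : ℝ} (hlam : (lam : 𝕜) ∈ resolventSetOf S.A)
    (hω : S.T.growthBound < (lam : EReal)) (hν : (ν : 𝕜) ∈ resolventSetOf S.A) (hlt : lam < ν)
    {v : U} (h : ∀ s, 0 ≤ s →
      Real.exp (lam * s) • S.Bop hlam v - S.T.op s (S.Bop hlam v) ∈ C) :
    S.Bop hν v ∈ C := by
  obtain ⟨ω, M, hωl, hM⟩ := S.T.exists_bound_of_growthBound_lt hω
  obtain ⟨R, h1, -, h2, -⟩ := S.exists_resolvent hM (hωl.trans hlt)
  rw [S.Bop_eq_add hν hlam h2]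
  set x := S.Bop hlam v with hx
  have hi1 : IntegrableOn (fun s : ℝ => Real.exp ((lam - ν) * s) • x) (Set.Ioi 0) :=
    (integrableOn_exp_mul_Ioi (by linarith) 0).smul_const x
  have hi2 := S.T.integrableOn_laplace hM (hωl.trans hlt) x
  -- The resolvent identity becomes a Laplace integral of `exp (lam s) x - T(s) x`, because `(ν -
  -- lam) ∫ exp ((lam - ν) s) ds = 1` over `(0, ∞)`.
  have e : x + ((lam : 𝕜) - (ν : 𝕜)) • R x = (ν - lam) • ∫ s in Set.Ioi (0 : ℝ),
      (Real.exp ((lam - ν) * s) • x - Real.exp (-(ν * s)) • S.T.ext s x) := by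
    have h3 : (ν - lam) * (-1 / (lam - ν)) = 1 := by
      have : lam - ν ≠ 0 := by linarith
      field_simp
      ring
    rw [integral_sub hi1 hi2, ← h1, integral_smul_const, integral_exp_mul_Ioi (by linarith),
      smul_sub, smul_smul, mul_zero, Real.exp_zero, h3, one_smul, ← RCLike.ofReal_sub,
      ← RCLike.real_smul_eq_coe_smul]
    module
  rw [e]
  refine hCsmul _ (by linarith) _ (integral_mem_of_isClosed_cone hC hC0 hCadd hCsmul ?_)
  filter_upwards [ae_restrict_mem measurableSet_Ioi] with s hs
  have hs' : 0 ≤ s := le_of_lt hs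
  have := hCsmul _ (Real.exp_pos (-(ν * s))).le _ (h s hs')
  rw [smul_sub, smul_smul, ← Real.exp_add] at this
  rw [S.T.ext_of_nonneg hs']
  convert this using 4
  ring

omit [CompleteSpace Y] in
/-- An element whose resolvents `R(ν, A) x` lie in a `T`-invariant closed convex cone for large `ν`
lies in the cone. -/
theorem mem_of_resolvent_mem (hC : IsClosed C) (hC0 : (0 : X) ∈ C)
    (hCadd : ∀ x ∈ C, ∀ y ∈ C, x + y ∈ C) (hCsmul : ∀ c : ℝ, 0 ≤ c → ∀ x ∈ C, c • x ∈ C)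
    (hT : ∀ s : ℝ, 0 ≤ s → ∀ x ∈ C, S.T.op s x ∈ C) {lam₀ : ℝ} {x : X}
    (h : ∀ ν : ℝ, lam₀ ≤ ν → ∀ R : X →L[𝕜] X, (∀ z, S.T.Gen (R z) ((ν : 𝕜) • R z - z)) →
      (∀ z y, S.T.Gen z y → R ((ν : 𝕜) • z - y) = z) → R x ∈ C) : x ∈ C := by
  -- The integral `z` lies in the domain of the generator, where `ν R(ν) z → z` with the explicit
  -- error `R(ν) A z`; dividing by `r → 0` afterwards recovers `x`.
  have hmean : ∀ r : ℝ, 0 ≤ r → ∫ s in (0 : ℝ)..r, S.T.ext s x ∈ C := by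
    intro r hr
    obtain ⟨z, hz⟩ : ∃ z, z = ∫ s in (0 : ℝ)..r, S.T.ext s x := ⟨_, rfl⟩
    obtain ⟨y, hy⟩ : ∃ y, S.T.Gen z y := by
      have := S.T.gen_integral x 0 hr le_rfl
      simp only [zero_mul, Real.exp_zero, one_smul] at this
      rw [intervalIntegral.integral_comp_sub_left (fun s => S.T.ext s x), sub_self, sub_zero,
        ← hz] at this
      exact ⟨_, this⟩
    rw [← hz, ← hC.closure_eq, Metric.mem_closure_iff]
    intro ε hε
    obtain ⟨ω, M, hM⟩ := S.T.exists_growth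
    have hM0 : 0 ≤ M := by simpa using (norm_nonneg _).trans (hM 0 le_rfl)
    -- Large enough that the error bound `M ‖y‖ / (ν - ω)` falls below `ε`.
    obtain ⟨ν, hν⟩ : ∃ ν, ν = max (max lam₀ 0) (ω + (M * ‖y‖ / ε + 1)) := ⟨_, rfl⟩
    have hνω : M * ‖y‖ / ε + 1 ≤ ν - ω := by
      have := hν ▸ le_max_right (max lam₀ 0) (ω + (M * ‖y‖ / ε + 1))
      linarith
    have hpos : 0 < M * ‖y‖ / ε + 1 := by positivity
    have hν0 : 0 ≤ ν := hν ▸ (le_max_right _ _).trans (le_max_left _ _)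
    obtain ⟨R, -, h1, h2, h3⟩ := S.exists_resolvent (lam := ν) hM (by linarith)
    have hRx := h ν (hν ▸ (le_max_left _ _).trans (le_max_left _ _)) R h1 h2
    have hRz : R z ∈ C := by
      rw [hz, ← R.intervalIntegral_comp_comm ((S.T.continuous_ext x).intervalIntegrable _ _),
        intervalIntegral.integral_of_le hr]
      refine integral_mem_of_isClosed_cone hC hC0 hCadd hCsmul ?_
      filter_upwards [ae_restrict_mem measurableSet_Ioc] with s hs
      rw [S.T.ext_of_nonneg hs.1.le, S.resolvent_op h1 h2 hs.1.le]
      exact hT s hs.1.le _ hRx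
    refine ⟨ν • R z, hCsmul _ hν0 _ hRz, ?_⟩
    have e : z - ν • R z = -R y := by
      have := h2 z y hy
      rw [← RCLike.real_smul_eq_coe_smul, map_sub, ContinuousLinearMap.map_smul_of_tower] at this
      nth_rw 1 [← this]
      abel
    rw [dist_eq_norm, e, norm_neg]
    calc ‖R y‖ ≤ M / (ν - ω) * ‖y‖ := R.le_of_opNorm_le h3 y
      _ = M * ‖y‖ / (ν - ω) := by ring
      _ ≤ M * ‖y‖ / (M * ‖y‖ / ε + 1) := by gcongr
      _ < ε := by
        rw [div_lt_iff₀ hpos, mul_add, mul_one, mul_div_cancel₀ _ hε.ne']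
        linarith
  have hd : HasDerivAt (fun u => ∫ s in (0 : ℝ)..u, S.T.ext s x) (S.T.ext 0 x) 0 :=
    (S.T.continuous_ext x).integral_hasStrictDerivAt 0 0 |>.hasDerivAt
  have hlim := hd.tendsto_slope_zero_right
  rw [S.T.ext_zero] at hlim
  refine hC.mem_of_tendsto hlim ?_
  filter_upwards [self_mem_nhdsWithin] with r hr
  have hr' : 0 ≤ r := le_of_lt hr
  rw [zero_add, intervalIntegral.integral_same, sub_zero]
  exact hCsmul _ (inv_nonneg.2 hr') _ (hmean r hr')

/-- With the control value rewritten at the point `ν`, its resolvent at `ν` is the integral of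
`T(t-s) B_ν u(s)`, whose integrand lies in the cone. -/
theorem exactPos_subset_of_Bop_mem (hC : IsClosed C) (hC0 : (0 : X) ∈ C)
    (hCadd : ∀ x ∈ C, ∀ y ∈ C, x + y ∈ C) (hCsmul : ∀ c : ℝ, 0 ≤ c → ∀ x ∈ C, c • x ∈ C)
    (hT : ∀ s : ℝ, 0 ≤ s → ∀ x ∈ C, S.T.op s x ∈ C) {μ : 𝕜} (hμ : μ ∈ resolventSetOf S.A)
    {p : ENNReal} (hp : 1 ≤ p) {K : Set U} {lam₀ : ℝ}
    (h : ∀ lam : ℝ, lam₀ ≤ lam →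
      ∃ hlam : (lam : 𝕜) ∈ resolventSetOf S.A, ∀ v ∈ K, S.Bop hlam v ∈ C)
    {t : ℝ} (ht : 0 ≤ t) : S.exactPos hμ p K t ⊆ C := by
  rintro x ⟨u, hu, huK, hx⟩
  refine mem_of_resolvent_mem hC hC0 hCadd hCsmul hT (lam₀ := lam₀) fun ν hν R h1 h2 => ?_
  obtain ⟨hν', hpos⟩ := h ν hν
  have hx' := (S.isControlValue_iff _ _ _ _).1
    (S.isControlValue_of hν' hμ ht (hu.integrable hp) hx)
  have e := h2 _ _ hx'
  rw [sub_sub_cancel] at e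
  rw [e, S.controlIntegral_eq hν' ht]
  refine integral_mem_of_isClosed_cone hC hC0 hCadd hCsmul ?_
  filter_upwards [huK, ae_restrict_mem measurableSet_Icc] with s hs hst
  rw [S.T.ext_of_nonneg (sub_nonneg.2 hst.2)]
  exact hT _ (sub_nonneg.2 hst.2) _ (hpos _ hs)

end BoundaryControlSystem

/-! ### The equivalences. -/

theorem proposition4p1 {𝕜 E X Y F U : Type*} [RCLike 𝕜]
    [NormedAddCommGroup E] [Lattice E] [HasSolidNorm E] [IsOrderedAddMonoid E]
    [NormedSpace ℝ E] [IsOrderedModule ℝ E]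
    [NormedAddCommGroup X] [NormedSpace ℝ X] [NormedSpace 𝕜 X] [IsScalarTower ℝ 𝕜 X]
    [CompleteSpace X]
    [NormedAddCommGroup Y] [NormedSpace 𝕜 Y] [CompleteSpace Y]
    [NormedAddCommGroup F] [Lattice F] [HasSolidNorm F] [IsOrderedAddMonoid F]
    [NormedSpace ℝ F] [IsOrderedModule ℝ F]
    [NormedAddCommGroup U] [NormedSpace ℝ U] [NormedSpace 𝕜 U] [IsScalarTower ℝ 𝕜 U]
    [CompleteSpace U]
    (LX : BanachLatticeOver 𝕜 E X) (LU : BanachLatticeOver 𝕜 F U)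
    (S : BoundaryControlSystem 𝕜 X Y U)
    (p : ENNReal) (hp : 1 ≤ p) (hB : S.IsAdmissible p)
    -- the point of the resolvent set with which the controllability maps are written
    (μ : 𝕜) (hμ : μ ∈ resolventSetOf S.A) :
    (∀ t : ℝ, 0 ≤ t → List.TFAE [
      S.exactPos hμ p LU.cone t ⊆ LX.cone,
      S.approxPos hμ p LU.cone t ⊆ LX.cone,
      ∃ (lam : ℝ) (hlam : (lam : 𝕜) ∈ resolventSetOf S.A),
        ∀ α β : ℝ, 0 ≤ α → α ≤ β → β ≤ t → ∀ v ∈ LU.cone,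
          Real.exp (lam * β) • S.T.op (t - β) (S.Bop hlam v)
            - Real.exp (lam * α) • S.T.op (t - α) (S.Bop hlam v) ∈ LX.cone]) ∧
    ((∀ s : ℝ, 0 ≤ s → ∀ x ∈ LX.cone, S.T.op s x ∈ LX.cone) →
      ∀ t : ℝ, 0 < t → List.TFAE [
        S.exactPos hμ p LU.cone t ⊆ LX.cone,
        S.approxPos hμ p LU.cone t ⊆ LX.cone,
        ∃ (lam : ℝ) (hlam : (lam : 𝕜) ∈ resolventSetOf S.A),
          ∀ α β : ℝ, 0 ≤ α → α ≤ β → β ≤ t → ∀ v ∈ LU.cone,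
            Real.exp (lam * β) • S.T.op (t - β) (S.Bop hlam v)
              - Real.exp (lam * α) • S.T.op (t - α) (S.Bop hlam v) ∈ LX.cone,
        S.exactPosAll hμ p LU.cone ⊆ LX.cone,
        S.approxPosAll hμ p LU.cone ⊆ LX.cone,
        ∃ (lam : ℝ) (hlam : (lam : 𝕜) ∈ resolventSetOf S.A), S.T.growthBound < (lam : EReal) ∧
          ∃ τ : ℝ, 0 < τ ∧ ∀ s : ℝ, 0 ≤ s → s ≤ τ → ∀ v ∈ LU.cone,
            Real.exp (lam * s) • S.Bop hlam v - S.T.op s (S.Bop hlam v) ∈ LX.cone,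
        ∃ lam₀ : ℝ, S.T.growthBound < (lam₀ : EReal) ∧ ∀ lam : ℝ, lam₀ ≤ lam →
          ∃ hlam : (lam : 𝕜) ∈ resolventSetOf S.A, ∀ v ∈ LU.cone, S.Bop hlam v ∈ LX.cone]) := by
  have hK0 := LU.zero_mem_cone
  have hKs := LU.smul_mem_cone
  have hC := LX.isClosed_cone
  have hC0 := LX.zero_mem_cone
  have hCa := LX.add_mem_cone
  have hCs := LX.smul_mem_cone
  have part1 : ∀ t : ℝ, 0 ≤ t → List.TFAE [
      S.exactPos hμ p LU.cone t ⊆ LX.cone,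
      S.approxPos hμ p LU.cone t ⊆ LX.cone,
      ∃ (lam : ℝ) (hlam : (lam : 𝕜) ∈ resolventSetOf S.A),
        ∀ α β : ℝ, 0 ≤ α → α ≤ β → β ≤ t → ∀ v ∈ LU.cone,
          Real.exp (lam * β) • S.T.op (t - β) (S.Bop hlam v)
            - Real.exp (lam * α) • S.T.op (t - α) (S.Bop hlam v) ∈ LX.cone] := by
    intro t ht
    tfae_have 1 → 2 := fun h => closure_minimal h hC
    tfae_have 2 → 1 := fun h => subset_closure.trans h
    tfae_have 1 → 3 := by
      intro h
      obtain ⟨lam, hl⟩ := S.T.exists_growthBound_lt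
      have hlam := S.mem_resolventSetOf_of_growthBound_lt hl
      rw [S.exactPos_eq hlam hμ hp _ ht] at h
      exact ⟨lam, hlam, fun α β hα hαβ hβ v hv =>
        BoundaryControlSystem.increments_mem_of_exactPos_subset hlam hK0 hKs h hα hαβ hβ hv⟩
    tfae_have 3 → 1 := by
      rintro ⟨lam, hlam, H⟩
      rw [S.exactPos_eq hlam hμ hp _ ht]
      exact BoundaryControlSystem.exactPos_subset_of_increments hp hB ht hC hC0 hCa
        LU.isClosed_cone hK0 hKs H
    tfae_finish
  refine ⟨part1, fun hT t ht => ?_⟩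
  tfae_have 1 ↔ 2 := (part1 t ht.le).out 0 1
  tfae_have 1 ↔ 3 := (part1 t ht.le).out 0 2
  tfae_have 1 → 6 := by
    intro h
    obtain ⟨lam, hl⟩ := S.T.exists_growthBound_lt
    have hlam := S.mem_resolventSetOf_of_growthBound_lt hl
    rw [S.exactPos_eq hlam hμ hp _ ht.le] at h
    refine ⟨lam, hlam, hl, t, ht, fun s hs hst v hv => ?_⟩
    -- The increment from `α = t - s` to `β = t`, multiplied by `exp (-lam (t - s))`, is the
    -- expression in (f); thus `τ = t` works.
    have h1 := BoundaryControlSystem.increments_mem_of_exactPos_subset hlam hK0 hKs h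
      (sub_nonneg.2 hst) (sub_le_self t hs) le_rfl hv
    have h2 := hCs _ (Real.exp_pos (-(lam * (t - s)))).le _ h1
    rw [smul_sub, smul_smul, smul_smul, ← Real.exp_add, ← Real.exp_add, neg_add_cancel,
      Real.exp_zero, one_smul, sub_self, S.T.op_zero, sub_sub_cancel,
      show -(lam * (t - s)) + lam * t = lam * s by ring] at h2
    exact h2
  tfae_have 6 → 7 := by
    rintro ⟨lam, hlam, hl, τ, hτ, H⟩
    have hlt : ∀ ν : ℝ, lam + 1 ≤ ν → lam < ν := fun ν hν => by linarith
    have hgb : ∀ ν : ℝ, lam < ν → S.T.growthBound < (ν : EReal) := fun ν hν =>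
      hl.trans (EReal.coe_lt_coe_iff.2 hν)
    -- The Laplace formula needs `ν > lam` strictly, hence the threshold `lam + 1`.
    refine ⟨lam + 1, hgb _ (hlt _ le_rfl), fun ν hν =>
      ⟨S.mem_resolventSetOf_of_growthBound_lt (hgb ν (hlt ν hν)), fun v hv => ?_⟩⟩
    exact BoundaryControlSystem.Bop_mem_of_exp_smul_sub_op_mem hC hC0 hCa hCs hlam hl _ (hlt ν hν)
      fun s hs => BoundaryControlSystem.exp_smul_sub_op_mem hCa hCs hT hτ
        (fun r hr hrτ => H r hr hrτ v hv) hs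
  tfae_have 7 → 4 := by
    rintro ⟨lam₀, -, H⟩
    exact Set.iUnion₂_subset fun r hr =>
      BoundaryControlSystem.exactPos_subset_of_Bop_mem hC hC0 hCa hCs hT hμ hp H hr
  tfae_have 4 → 1 := fun h =>
    (Set.subset_biUnion_of_mem (u := fun r => S.exactPos hμ p LU.cone r) (Set.mem_Ici.2 ht.le)).trans h
  tfae_have 4 → 5 := fun h =>
    closure_minimal (Set.iUnion₂_subset fun r hr => closure_minimal
      ((Set.subset_biUnion_of_mem (u := fun r => S.exactPos hμ p LU.cone r) hr).trans h) hC) hC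
  tfae_have 5 → 4 := fun h =>
    (Set.iUnion₂_mono fun _ _ => subset_closure).trans (subset_closure.trans h)
  tfae_finish
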